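/- A strict partition is a finite sequence $\lambda=(\lambda_1>\lambda_2>\dots>\lambda_\ell>0)$ of integers; set $\lambda_i=0$ for $i>\ell$ and $|\lambda|=\sum_i\lambda_i$. Write $\mu\subseteq\lambda$ if $\mu_i\le\lambda_i$ for all $i$, and in that case let $|\lambda/\mu|=|\lambda|-|\mu|$ and $$\mathsf{SD}_{\lambda/\mu}=\{(i,i+j-1)\in\mathbb{Z}_{>0}\times\mathbb{Z}_{>0} : \mu_i<j\le\lambda_i\}.$$ Let $\mathbb{M}=\{1'<1<2'<2<\cdots\}$ be the totally ordered marked alphabet, and put $|k'|=|k|=k$. For finite nonempty $S,T\subset\mathbb{M}$ write $S\preceq T$ if $\max S\le\min T$. A semistandard shifted set-valued (marked) tableau of shape $\lambda/\mu$ is a filling $T$ of $\mathsf{SD}_{\lambda/\mu}$ by finite nonempty subsets of $\mathbb{M}$ that is weakly increasing along rows and down columns in the sense of $\preceq$, such that no unprimed number appears twice in the same column and no primed number appears twice in the same row. Let $\mathrm{SetSSMT}(\lambda/\mu)$ be the set of these tableaux, and for such a $T$ let $|T|=\sum_{c}|T(c)|$ and $x^T=\prod_{c}\prod_{m\in T(c)}x_{|m|}$,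 where $c$ runs over $\mathsf{SD}_{\lambda/\mu}$. Define, in $\mathbb{Z}[\beta][[x_1,x_2,\dots]]$, $$GQ^{(\beta)}_{\lambda/\mu}=\sum_{T\in\mathrm{SetSSMT}(\lambda/\mu)}\beta^{|T|-|\lambda/\mu|}x^T,\qquad GP^{(\beta)}_{\lambda/\mu}=\sum_{T}\beta^{|T|-|\lambda/\mu|}x^T,$$ where the second sum is over those $T\in\mathrm{SetSSMT}(\lambda/\mu)$ whose entries in the boxes $(i,i)$ on the main diagonal contain only unprimed numbers. A power series $f\in\mathbb{Z}[\beta][[x_1,x_2,\dots]]$ is symmetric if the coefficients of $x_1^{a_1}\cdots x_k^{a_k}$ and $x_{i_1}^{a_1}\cdots x_{i_k}^{a_k}$ in $f$ are equal for all $a_1,\dots,a_k\in\mathbb{Z}_{>0}$ and all distinct positive integers $i_1,\dots,i_k$. **Theorem.** Let $\mu\subseteq\lambda$ be strict partitions. Then the power series $GP^{(\beta)}_{\lambda/\mu}$ and $GQ^{(\beta)}_{\lambda/\mu}$ are symmetric. -/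

import Mathlib

open scoped Polynomial

namespace ShiftedK

/-- A strict partition `λ = (λ₁ > λ₂ > ⋯ > λ_ℓ > 0)`, padded by zeros. Rows are numbered from `0`,
so `parts i` is the part usually written `λ_{i+1}`. Parts strictly decrease as long as they are
nonzero, so only finitely many are nonzero. -/
structure StrictPartition where
  parts : ℕ → ℕ
  antitone : Antitone parts
  strict : ∀ i, parts i ≠ 0 → parts (i + 1) < parts i

/-- Containment `μ ⊆ λ` of strict partitions: `μ_i ≤ λ_i` for all `i`. -/
instance : HasSubset StrictPartition where
  Subset mu lam := ∀ i, mu.parts i ≤ lam.parts i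

/-- The shifted skew diagram of `λ/μ`. Rows and columns are both numbered from `0`, so that
`{(i, i + j - 1) : μ_i < j ≤ λ_i}` becomes `{(i, i + j) : μ_i ≤ j < λ_i}`. -/
def SD (lam mu : StrictPartition) : Set (ℕ × ℕ) :=
  {p | ∃ j, p.2 = p.1 + j ∧ mu.parts p.1 ≤ j ∧ j < lam.parts p.1}

theorem StrictPartition.add_le (lam : StrictPartition) (i : ℕ) (h : lam.parts i ≠ 0) :
    lam.parts i + i ≤ lam.parts 0 := by
  induction i with
  | zero => simp
  | succ k ih =>
    have hk : lam.parts k ≠ 0 := by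
      have := lam.antitone (Nat.le_succ k)
      intro h0
      exact h (by simpa [h0] using this)
    have := lam.strict k hk
    have := ih hk
    omega

theorem SD_finite (lam mu : StrictPartition) : (SD lam mu).Finite := by
  refine ((Set.finite_Iio (lam.parts 0)).prod (Set.finite_Iio (lam.parts 0))).subset ?_
  rintro ⟨i, c⟩ ⟨j, hc, _, hj⟩
  have hi := lam.add_le i (by simp only at hj; omega)
  simp only at hc hj
  simp only [Set.mem_prod, Set.mem_Iio]
  omega

noncomputable instance (lam mu : StrictPartition) : Fintype (SD lam mu) :=
  (SD_finite lam mu).fintype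

/-- The marked alphabet `1' < 1 < 2' < 2 < ⋯`. The pair `(k, false)` is the primed number `(k+1)'`
and `(k, true)` is the unprimed number `k+1`; the order is lexicographic, with `false < true`. -/
abbrev Marked : Type := ℕ ×ₗ Bool

/-- The index `|m|` of the variable attached to a marked number; the variable `x_{k+1}` has
index `k`. -/
def Marked.abs (m : Marked) : ℕ := (ofLex m).1

def Marked.IsPrimed (m : Marked) : Prop := (ofLex m).2 = false

def Marked.IsUnprimed (m : Marked) : Prop := (ofLex m).2 = true

/-- `max S ≤ min T`, for finite nonempty sets of marked numbers. -/
def SetLE (S T : Finset Marked) : Prop := ∀ s ∈ S, ∀ t ∈ T, s ≤ t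

/-- A filling of the boxes of the shifted skew diagram of `λ/μ` by finite sets of marked numbers. -/
abbrev Filling (lam mu : StrictPartition) : Type := SD lam mu → Finset Marked

/-- Semistandard shifted set-valued marked tableaux of shape `λ/μ`. -/
structure IsSetSSMT {lam mu : StrictPartition} (T : Filling lam mu) : Prop where
  nonempty : ∀ c, (T c).Nonempty
  /-- entries weakly increase along rows -/
  row_le : ∀ c d : SD lam mu, c.1.1 = d.1.1 → c.1.2 < d.1.2 → SetLE (T c) (T d)
  /-- entries weakly increase down columns -/
  col_le : ∀ c d : SD lam mu, c.1.2 = d.1.2 → c.1.1 < d.1.1 → SetLE (T c) (T d)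
  /-- no primed number appears twice in the same row -/
  row_primed : ∀ c d : SD lam mu, c.1.1 = d.1.1 → c ≠ d →
    ∀ m ∈ T c, m.IsPrimed → m ∉ T d
  /-- no unprimed number appears twice in the same column -/
  col_unprimed : ∀ c d : SD lam mu, c.1.2 = d.1.2 → c ≠ d →
    ∀ m ∈ T c, m.IsUnprimed → m ∉ T d

def SetSSMT (lam mu : StrictPartition) : Set (Filling lam mu) := {T | IsSetSSMT T}

/-- The tableaux whose entries on the main diagonal contain only unprimed numbers. -/
def SetSSMTP (lam mu : StrictPartition) : Set (Filling lam mu) :=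
  {T | IsSetSSMT T ∧ ∀ c : SD lam mu, c.1.1 = c.1.2 → ∀ m ∈ T c, m.IsUnprimed}

/-- `|T|`, the total number of entries. -/
noncomputable def size {lam mu : StrictPartition} (T : Filling lam mu) : ℕ := ∑ c, (T c).card

/-- The exponent of the monomial `x^T = ∏_c ∏_{m ∈ T(c)} x_{|m|}`. -/
noncomputable def weight {lam mu : StrictPartition} (T : Filling lam mu) : ℕ →₀ ℕ :=
  ∑ c, ∑ m ∈ T c, Finsupp.single m.abs 1

/-- Only finitely many fillings contribute to each monomial. -/
theorem fiber_finite {lam mu : StrictPartition} (S : Set (Filling lam mu)) (e : ℕ →₀ ℕ) :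
    {T | T ∈ S ∧ weight T = e}.Finite := by
  classical
  let F : Finset Marked := (e.support ×ˢ Finset.univ).map toLex.toEmbedding
  have hF : {T : Filling lam mu | ∀ c, T c ∈ F.powerset}.Finite := by
    have := Set.Finite.pi' (ι := SD lam mu) (t := fun _ => (F.powerset : Set (Finset Marked)))
      (fun _ => Finset.finite_toSet _)
    simpa using this
  refine hF.subset ?_
  rintro T ⟨-, hT⟩ c
  rw [Finset.mem_powerset]
  intro m hm
  have h1 : Finsupp.single m.abs 1 ≤ e := by
    rw [← hT]
    calc Finsupp.single m.abs 1 ≤ ∑ m ∈ T c, Finsupp.single m.abs 1 :=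
          Finset.single_le_sum (f := fun m : Marked => (Finsupp.single m.abs 1 : ℕ →₀ ℕ))
            (fun _ _ => zero_le) hm
      _ ≤ weight T :=
          Finset.single_le_sum
            (f := fun c => ∑ m ∈ T c, (Finsupp.single m.abs 1 : ℕ →₀ ℕ))
            (fun _ _ => zero_le) (Finset.mem_univ c)
  have h2 : e m.abs ≠ 0 := by
    have := h1 m.abs
    simp at this
    omega
  refine Finset.mem_map.2 ⟨ofLex m, ?_, rfl⟩
  simpa [Marked.abs] using h2

/-- The power series `∑_{T ∈ S} β^{|T| - |λ/μ|} x^T` in `ℤ[β]⟦x₁, x₂, …⟧`, given by its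
coefficients; `β` is the polynomial variable. -/
noncomputable def genFun {lam mu : StrictPartition} (S : Set (Filling lam mu)) :
    MvPowerSeries ℕ ℤ[X] :=
  fun e => ∑ T ∈ (fiber_finite S e).toFinset,
    (Polynomial.X : ℤ[X]) ^ (size T - Fintype.card (SD lam mu))

/-- The skew `K`-theoretic Schur `Q`-function. -/
noncomputable def GQ (lam mu : StrictPartition) : MvPowerSeries ℕ ℤ[X] := genFun (SetSSMT lam mu)

/-- The skew `K`-theoretic Schur `P`-function. -/
noncomputable def GP (lam mu : StrictPartition) : MvPowerSeries ℕ ℤ[X] := genFun (SetSSMTP lam mu)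

/-- The `ℤ[β]`-module of symmetric power series (of possibly unbounded degree): those for which the
coefficients of `x_1^{a_1} ⋯ x_k^{a_k}` and `x_{i_1}^{a_1} ⋯ x_{i_k}^{a_k}` agree for all positive
`a_1, …, a_k` and all distinct `i_1, …, i_k`. -/
noncomputable def mSym : Submodule ℤ[X] (MvPowerSeries ℕ ℤ[X]) where
  carrier := {f | ∀ (k : ℕ) (a : Fin k → ℕ) (i : Fin k → ℕ), (∀ j, 0 < a j) →
    Function.Injective i →
      MvPowerSeries.coeff (∑ j, Finsupp.single (i j) (a j)) f =
        MvPowerSeries.coeff (∑ j : Fin k, Finsupp.single (j : ℕ) (a j)) f}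
  add_mem' := by
    intro f g hf hg k a i ha hi
    simp only [map_add, hf k a i ha hi, hg k a i ha hi]
  zero_mem' := by
    intro k a i _ _
    simp
  smul_mem' := by
    intro r f hf k a i ha hi
    simp only [MvPowerSeries.coeff_smul, hf k a i ha hi]

end ShiftedK

/-! Let `u_i` be the operator that adds a box of content `i` to a shifted shape, multiplies by `β`
if the shape already has a removable corner of content `i`, and is zero otherwise. Put `h_i(x) = 1 +
x u_i`. A set-valued tableau is built by inserting its letters in increasing order, each into a new
box or into an existing corner. For one index `k`, the primed letters are inserted by decreasing
content and then the unprimed ones by increasing content, so together they contribute `H(x_k) =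
h_n(x_k) ⋯ h_1(x_k) h_0(a) h_1(x_k) ⋯ h_n(x_k)`. With `x ⊕ y = x + y + βxy`, the middle argument is
`a = x_k ⊕ x_k` for `GQ`, and `a = x_k` for `GP`, where no primed letter is allowed on the diagonal.
The coefficients of the series are matrix entries of products of the `H(x_k)`, so symmetry follows
once the `H(x_k)` commute.

Commutation rests on `h_i(x) h_i(y) = h_i(x ⊕ y)` and two Yang–Baxter equations: type A away from
the main diagonal (`descProd_commute`) and type B for `u_0, u_1` (`hProd_commute`). The dictionary
with tableaux is `opProd_apply` and `coeff_opProd`. -/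

namespace ShiftedK

/-! ### Yang–Baxter equations and commuting products -/

section Algebra

variable {R E : Type*} [CommRing R] [Ring E] [Algebra R E]

/-- The factor `1 + x u_i`. -/
def hFactor (u : ℕ → E) (i : ℕ) (x : R) : E := 1 + x • u i

/-- The relations satisfied by the box-adding operators on shifted shapes. -/
structure BoxRelations (β : R) (u : ℕ → E) : Prop where
  sq : ∀ i, u i * u i = β • u i
  comm : ∀ i j, i + 1 < j → u i * u j = u j * u i
  up_down : ∀ i, u (i + 1) * (u (i + 2) * u (i + 1)) = 0
  down_up : ∀ i, u (i + 1) * (u i * u (i + 1)) = 0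

/-- `h_{a+n-1}(x) ⋯ h_{a+1}(x) h_a(x)` -/
def descProd (u : ℕ → E) (x : R) (a : ℕ) : ℕ → E
  | 0 => 1
  | n + 1 => hFactor u (a + n) x * descProd u x a n

/-- `h_a(x) h_{a+1}(x) ⋯ h_{a+n-1}(x)` -/
def ascProd (u : ℕ → E) (x : R) (a : ℕ) : ℕ → E
  | 0 => 1
  | n + 1 => ascProd u x a n * hFactor u (a + n) x

theorem descProd_succ' (u : ℕ → E) (x : R) (a n : ℕ) :
    descProd u x a (n + 1) = descProd u x (a + 1) n * hFactor u a x := by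
  induction n with
  | zero => simp [descProd]
  | succ n ih => rw [descProd, ih, descProd, mul_assoc, Nat.add_right_comm a 1 n, add_assoc a n 1]

theorem ascProd_succ' (u : ℕ → E) (x : R) (a n : ℕ) :
    ascProd u x a (n + 1) = hFactor u a x * ascProd u x (a + 1) n := by
  induction n with
  | zero => simp [ascProd]
  | succ n ih => rw [ascProd, ih, ascProd, mul_assoc, Nat.add_right_comm a 1 n, add_assoc a n 1]

namespace BoxRelations

variable {β : R} {u : ℕ → E} (hu : BoxRelations β u)
include hu

theorem hFactor_mul (i : ℕ) (x y : R) :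
    hFactor u i x * hFactor u i y = hFactor u i (x + y + β * x * y) := by
  simp only [hFactor, mul_add, add_mul, one_mul, mul_one, smul_mul_assoc, mul_smul_comm, smul_smul,
    hu.sq]
  module

theorem hFactor_commute (i : ℕ) (x y : R) : Commute (hFactor u i x) (hFactor u i y) := by
  rw [Commute, SemiconjBy, hu.hFactor_mul, hu.hFactor_mul]
  congr 1
  ring

theorem hFactor_mul_inv (i : ℕ) {x x' : R} (h : x + x' + β * x * x' = 0) :
    hFactor u i x * hFactor u i x' = 1 := by
  rw [hu.hFactor_mul, h]
  simp [hFactor]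

theorem hFactor_commute_far {i j : ℕ} (h : i + 1 < j) (x y : R) :
    Commute (hFactor u i x) (hFactor u j y) := by
  have : Commute (u i) (u j) := hu.comm i j h
  unfold hFactor
  exact ((Commute.one_right _).add_right (((Commute.one_left _).add_left
    ((this.smul_left x).smul_right y))))

theorem hFactor_commute_descProd {i a : ℕ} (h : i + 1 < a) (x y : R) (n : ℕ) :
    Commute (hFactor u i x) (descProd u y a n) := by
  induction n with
  | zero => exact Commute.one_right _
  | succ n ih => exact (hu.hFactor_commute_far (by omega) x y).mul_right ih

theorem hFactor_commute_ascProd {i a : ℕ} (h : i + 1 < a) (x y : R) (n : ℕ) :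
    Commute (hFactor u i x) (ascProd u y a n) := by
  induction n with
  | zero => exact Commute.one_right _
  | succ n ih => exact ih.mul_right (hu.hFactor_commute_far (by omega) x y)

theorem hFactor_commute_descProd_above {i a : ℕ} (n : ℕ) (h : a + n < i) (x y : R) :
    Commute (hFactor u i x) (descProd u y a n) := by
  induction n with
  | zero => exact Commute.one_right _
  | succ n ih =>
    exact (hu.hFactor_commute_far (by omega) y x).symm.mul_right (ih (by omega))

theorem descProd_mul_ascProd {x x' : R} (h : x + x' + β * x * x' = 0) (a n : ℕ) :
    descProd u x a n * ascProd u x' a n = 1 := by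
  induction n with
  | zero => simp [descProd, ascProd]
  | succ n ih =>
    rw [descProd, ascProd, mul_assoc, ← mul_assoc (descProd u x a n), ih, one_mul,
      hu.hFactor_mul_inv _ h]

theorem ascProd_mul_descProd {x x' : R} (h : x + x' + β * x * x' = 0) (a n : ℕ) :
    ascProd u x a n * descProd u x' a n = 1 := by
  induction n generalizing a with
  | zero => simp [descProd, ascProd]
  | succ n ih =>
    rw [descProd_succ', ascProd_succ', mul_assoc, ← mul_assoc (ascProd u x (a + 1) n), ih, one_mul,
      hu.hFactor_mul_inv _ h]

/-- The Yang–Baxter equation of type `A`. -/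
theorem yangBaxterA (i : ℕ) {x y w : R} (hw : y = x + w + β * x * w) :
    hFactor u (i + 2) x * (hFactor u (i + 1) x * (hFactor u (i + 2) y * hFactor u (i + 1) w)) =
      hFactor u (i + 2) y * (hFactor u (i + 1) y * hFactor u (i + 2) x) := by
  have h1 := hu.up_down i
  have h2 := hu.down_up (i + 1)
  have h5 : ∀ j t, u j * (u j * t) = β • (u j * t) := fun j t => by
    rw [← mul_assoc, hu.sq, smul_mul_assoc]
  subst hw
  simp only [hFactor, mul_add, add_mul, one_mul, mul_one, smul_mul_assoc, mul_smul_comm, smul_smul,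
    mul_assoc, hu.sq, h1, h2, h5, smul_zero, add_zero]
  module

/-- The Yang–Baxter equation of type `B`. -/
theorem yangBaxterB {a b s w : R} (h : a * s = b * s + w * (a + b + β * a * b) + β * b * s * w) :
    hFactor u 1 w * (hFactor u 0 a * (hFactor u 1 s * hFactor u 0 b)) =
      hFactor u 0 b * (hFactor u 1 s * (hFactor u 0 a * hFactor u 1 w)) := by
  have h1 : u 1 * (u 0 * u 1) = 0 := hu.down_up 0
  have h3 : ∀ t, u 1 * (u 0 * (u 1 * t)) = 0 := fun t => by
    simp only [← mul_assoc] at h1 ⊢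
    rw [h1, zero_mul]
  have h5 : ∀ j t, u j * (u j * t) = β • (u j * t) := fun j t => by
    rw [← mul_assoc, hu.sq, smul_mul_assoc]
  simp only [hFactor, mul_add, add_mul, one_mul, mul_one, smul_mul_assoc, mul_smul_comm, smul_smul,
    hu.sq, h1, h3, h5, smul_zero, add_zero]
  -- The coefficients of `u 0`, `u 1` and `u 0 * u 1 * u 0` agree on both sides. Those of `u 0 * u
  -- 1` and of `u 1 * u 0` agree precisely by `h`.
  linear_combination (norm := module) h • (u 0 * u 1) - h • (u 1 * u 0)

/-- Induction on the length: the top two factors are exchanged by the type A equation, the rest by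
the induction hypothesis. The indices start at `i + 1` because `u 0 * u 1 * u 0` need not vanish. -/
theorem descProd_commute (n i : ℕ) {x y : R} {x' : R} (hx : x + x' + β * x * x' = 0) :
    Commute (descProd u x (i + 1) n) (descProd u y (i + 1) n) := by
  induction n using Nat.twoStepInduction with
  | zero => exact Commute.one_right _
  | one => simpa [descProd] using hu.hFactor_commute (i + 1) x y
  | more n _ ih =>
    have hinv : hFactor u (i + 1 + n) x' * hFactor u (i + 1 + n) x = 1 :=
      hu.hFactor_mul_inv _ (by linear_combination hx)
    -- The induction hypothesis with the top factor of the left `x`-product cancelled.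
    have key : descProd u x (i + 1) n * descProd u y (i + 1) (n + 1) =
        hFactor u (i + 1 + n) (y + x' + β * y * x') *
          (descProd u y (i + 1) n * descProd u x (i + 1) (n + 1)) := by
      have e1 : descProd u x (i + 1) n = hFactor u (i + 1 + n) x' * descProd u x (i + 1) (n + 1) := by
        rw [descProd, ← mul_assoc, hinv, one_mul]
      rw [e1, mul_assoc, ih.eq, ← hu.hFactor_mul, (hu.hFactor_commute _ y x').eq]
      simp only [descProd, mul_assoc]
    -- This `w` satisfies `x ⊕ w = y`. Multiplied on the right by `h_{i+1+n}(x)`, the equation says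
    -- that the products of two factors at `x` and at `y` commute.
    have yb := hu.yangBaxterA (i + n) (x := x) (y := y) (w := y + x' + β * y * x')
      (by linear_combination (-1 - β * y) * hx)
    have e : i + n + 1 = i + 1 + n := by omega
    have e' : i + n + 2 = i + 1 + (n + 1) := by omega
    rw [e, e'] at yb
    have c : ∀ v t : R, Commute (hFactor u (i + 1 + (n + 1)) v) (descProd u t (i + 1) n) :=
      fun v t => hu.hFactor_commute_descProd_above n (by omega) v t
    have expand : ∀ p q : R, descProd u p (i + 1) (n + 2) * descProd u q (i + 1) (n + 2) =
        hFactor u (i + 1 + (n + 1)) p * (hFactor u (i + 1 + n) p *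
          (hFactor u (i + 1 + (n + 1)) q *
          (descProd u p (i + 1) n * descProd u q (i + 1) (n + 1)))) := by
      intro p q
      rw [descProd, descProd, descProd]
      rw [← mul_assoc (hFactor u (i + 1 + (n + 1)) q), (c q p).eq]
      simp only [mul_assoc]
    rw [Commute, SemiconjBy, expand, expand, key]
    rw [← mul_assoc, ← mul_assoc, ← mul_assoc, ← mul_assoc, ← mul_assoc, ← mul_assoc]
    simp only [← mul_assoc] at yb ⊢
    rw [yb]

/-- The ascending product at `x` is the inverse of the descending product at the formal inverse
`x'`, so commutation passes from one to the other. -/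
theorem ascProd_commute_descProd (n i : ℕ) {x x' y : R} (hx : x + x' + β * x * x' = 0) :
    Commute (ascProd u x (i + 1) n) (descProd u y (i + 1) n) := by
  have h1 := hu.descProd_mul_ascProd (x := x') (x' := x) (by linear_combination hx) (i + 1) n
  have h2 := hu.ascProd_mul_descProd hx (i + 1) n
  exact (hu.descProd_commute n i (x := x') (x' := x) (y := y) (by linear_combination hx)).units_inv_left
    (u := ⟨descProd u x' (i + 1) n, ascProd u x (i + 1) n, h1, h2⟩)

theorem ascProd_commute (n i : ℕ) {x y y' : R} {x' : R} (hx : x + x' + β * x * x' = 0)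
    (hy : y + y' + β * y * y' = 0) :
    Commute (ascProd u x (i + 1) n) (ascProd u y (i + 1) n) := by
  have h := hu.ascProd_commute_descProd n i (y := y') hx
  have h1 := hu.descProd_mul_ascProd (x := y') (x' := y) (by linear_combination hy) (i + 1) n
  have h2 := hu.ascProd_mul_descProd hy (i + 1) n
  exact (h.units_inv_right (u := ⟨descProd u y' (i + 1) n, ascProd u y (i + 1) n, h1, h2⟩))

/-- The products `h_n(x) ⋯ h_1(x) h_0(a) h_1(x) ⋯ h_n(x)` commute. -/
theorem hProd_commute (n : ℕ) {x x' y y' a b : R} (hx : x + x' + β * x * x' = 0)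
    (hy : y + y' + β * y * y' = 0)
    (hab : a * (x + y + β * x * y) = b * (x + y + β * x * y) +
      (x + y' + β * x * y') * (a + b + β * a * b) +
      β * b * (x + y + β * x * y) * (x + y' + β * x * y')) :
    Commute (descProd u x 1 n * hFactor u 0 a * ascProd u x 1 n)
      (descProd u y 1 n * hFactor u 0 b * ascProd u y 1 n) := by
  cases n with
  | zero => simpa [descProd, ascProd] using hu.hFactor_commute 0 a b
  | succ n =>
  have hD := (hu.descProd_commute (n + 1) 0 (y := y) hx).eq
  have hA := (hu.ascProd_commute (n + 1) 0 hx hy).eq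
  have hs : ∀ p q : R, hFactor u 1 p * hFactor u 1 q = hFactor u 1 (p + q + β * p * q) :=
    fun p q => hu.hFactor_mul 1 p q
  -- The inner ascending and descending products are interchanged. Their factors of index at least 2
  -- then move past `h_0`, leaving a core in `u 0` and `u 1` only.
  have expand : ∀ {p p' q c d : R}, p + p' + β * p * p' = 0 →
      (descProd u p 1 (n + 1) * hFactor u 0 c * ascProd u p 1 (n + 1)) *
      (descProd u q 1 (n + 1) * hFactor u 0 d * ascProd u q 1 (n + 1)) =
      (descProd u p 1 (n + 1) * descProd u q 2 n) *
      (hFactor u 0 c * (hFactor u 1 (q + p + β * q * p) * hFactor u 0 d)) *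
      (ascProd u p 2 n * ascProd u q 1 (n + 1)) := by
    intro p p' q c d hp
    have e1 := (hu.ascProd_commute_descProd (n + 1) 0 (y := q) hp).eq
    calc _ = descProd u p 1 (n + 1) * hFactor u 0 c *
          (ascProd u p 1 (n + 1) * descProd u q 1 (n + 1)) * hFactor u 0 d *
          ascProd u q 1 (n + 1) := by simp only [mul_assoc]
      _ = descProd u p 1 (n + 1) * (hFactor u 0 c * descProd u q 2 n) *
          (hFactor u 1 q * hFactor u 1 p) * (ascProd u p 2 n * hFactor u 0 d) *
          ascProd u q 1 (n + 1) := by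
        rw [e1, descProd_succ' u q, ascProd_succ' u p]
        simp only [mul_assoc]
      _ = _ := by
        rw [hs, (hu.hFactor_commute_descProd (by norm_num) c q n).eq,
          ← (hu.hFactor_commute_ascProd (by norm_num) d p n).eq]
        simp only [mul_assoc]
  -- Exchanging `x` and `y` in the outer factors costs `h_1(x ⊕ y')`. The type B equation carries
  -- this factor through the core, and `hAs` absorbs it on the right.
  have hDs : descProd u x 1 (n + 1) * descProd u y 2 n =
      descProd u y 1 (n + 1) * descProd u x 2 n * hFactor u 1 (x + y' + β * x * y') := by
    rw [← hs, ← mul_assoc, mul_assoc (descProd u y 1 (n + 1)), ← descProd_succ', ← hD,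
      descProd_succ' u y, mul_assoc, mul_assoc, hu.hFactor_mul_inv 1 hy, mul_one]
  have hAs : hFactor u 1 (x + y' + β * x * y') * (ascProd u x 2 n * ascProd u y 1 (n + 1)) =
      ascProd u y 2 n * ascProd u x 1 (n + 1) := by
    have hy' : hFactor u 1 y' * hFactor u 1 y = 1 :=
      hu.hFactor_mul_inv 1 (by linear_combination hy)
    rw [show x + y' + β * x * y' = y' + x + β * y' * x by ring, ← hs, mul_assoc,
      ← mul_assoc (hFactor u 1 x), ← ascProd_succ', hA, ascProd_succ' u y, mul_assoc,
      ← mul_assoc, hy', one_mul]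
  have yb := hu.yangBaxterB hab
  rw [Commute, SemiconjBy, expand hx, expand hy, hDs,
    show y + x + β * y * x = x + y + β * x * y by ring]
  calc _ = descProd u y 1 (n + 1) * descProd u x 2 n *
        (hFactor u 1 (x + y' + β * x * y') *
        (hFactor u 0 a * (hFactor u 1 (x + y + β * x * y) * hFactor u 0 b))) *
        (ascProd u x 2 n * ascProd u y 1 (n + 1)) := by simp only [mul_assoc]
    _ = _ := by
      rw [yb, ← hAs]
      simp only [mul_assoc]

/-- The operators for the `P`-functions commute. -/
theorem hProdP_commute (n : ℕ) {x x' y y' : R} (hx : x + x' + β * x * x' = 0)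
    (hy : y + y' + β * y * y' = 0) :
    Commute (descProd u x 1 n * hFactor u 0 x * ascProd u x 1 n)
      (descProd u y 1 n * hFactor u 0 y * ascProd u y 1 n) :=
  hu.hProd_commute n hx hy
    (by linear_combination (-(1 + β * x) * (x + y + β * x * y)) * hy)

/-- The operators for the `Q`-functions commute. -/
theorem hProdQ_commute (n : ℕ) {x x' y y' : R} (hx : x + x' + β * x * x' = 0)
    (hy : y + y' + β * y * y' = 0) :
    Commute (descProd u x 1 n * hFactor u 0 (x + x + β * x * x) * ascProd u x 1 n)
      (descProd u y 1 n * hFactor u 0 (y + y + β * y * y) * ascProd u y 1 n) := by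
  refine hu.hProd_commute n hx hy ?_
  -- Since `x = w ⊕ y`, the type B condition becomes a polynomial identity in `w`, `y` and `β`.
  obtain ⟨w, hw⟩ : ∃ w, w = x + y' + β * x * y' := ⟨_, rfl⟩
  have hxw : x = w + y + β * w * y := by
    linear_combination (-(1 + β * x)) * hy - (1 + β * y) * hw
  rw [← hw, hxw]
  ring

end BoxRelations

end Algebra

end ShiftedK

namespace ShiftedK

/-! ### Box-adding operators on shifted shapes -/

section Operators

/-- A box can be added to the end of the diagonal of content `i`, where `d` records the lengths of
the diagonals of a shifted shape containing the shape recorded by `m`. -/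
def Addable (m : ℕ → ℕ) (i : ℕ) (d : ℕ → ℕ) : Prop :=
  (∀ j, j + 1 = i → d j = d i + 1) ∧ d (i + 1) = d i ∧ m i ≤ d i

/-- The last box on the diagonal of content `i` is a removable corner outside of `m`. -/
def Removable (m : ℕ → ℕ) (i : ℕ) (d : ℕ → ℕ) : Prop :=
  (∀ j, j + 1 = i → d j = d i) ∧ d (i + 1) + 1 = d i ∧ m i < d i

/-- Adding a box on the diagonal of content `i`. -/
def addBox (i : ℕ) (d : ℕ → ℕ) : ℕ → ℕ := Function.update d i (d i + 1)

theorem addBox_apply (i j : ℕ) (d : ℕ → ℕ) : addBox i d j = if j = i then d i + 1 else d j := by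
  rw [addBox, Function.update_apply]

theorem addBox_comm {i j : ℕ} (h : i ≠ j) (d : ℕ → ℕ) :
    addBox i (addBox j d) = addBox j (addBox i d) := by
  ext k
  simp only [addBox_apply]
  grind

theorem Addable.not_removable {m d : ℕ → ℕ} {i : ℕ} (h : Addable m i d) : ¬ Removable m i d :=
  fun h' => by have := h.2.1; have := h'.2.1; omega

theorem Addable.removable_addBox {m d : ℕ → ℕ} {i : ℕ} (h : Addable m i d) :
    Removable m i (addBox i d) := by
  obtain ⟨h1, h2, h3⟩ := h
  refine ⟨fun j hj => ?_, ?_, ?_⟩ <;> simp only [addBox_apply]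
  · have := h1 j hj
    grind
  · grind
  · grind

theorem addable_addBox_iff {m d : ℕ → ℕ} {i j : ℕ} (h : i + 1 < j ∨ j + 1 < i) :
    Addable m i (addBox j d) ↔ Addable m i d := by
  unfold Addable
  have h1 : addBox j d i = d i := by rw [addBox_apply, if_neg (by omega)]
  have h2 : addBox j d (i + 1) = d (i + 1) := by rw [addBox_apply, if_neg (by omega)]
  have h3 : ∀ k, k + 1 = i → addBox j d k = d k := fun k hk => by
    rw [addBox_apply, if_neg (by omega)]
  rw [h1, h2]
  grind

theorem removable_addBox_iff {m d : ℕ → ℕ} {i j : ℕ} (h : i + 1 < j ∨ j + 1 < i) :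
    Removable m i (addBox j d) ↔ Removable m i d := by
  unfold Removable
  have h1 : addBox j d i = d i := by rw [addBox_apply, if_neg (by omega)]
  have h2 : addBox j d (i + 1) = d (i + 1) := by rw [addBox_apply, if_neg (by omega)]
  have h3 : ∀ k, k + 1 = i → addBox j d k = d k := fun k hk => by
    rw [addBox_apply, if_neg (by omega)]
  rw [h1, h2]
  grind

variable {R : Type*} [CommRing R]

open Classical in
/-- The box-adding operator, acting on functions of the shape. -/
noncomputable def boxOp (β : R) (m : ℕ → ℕ) (i : ℕ) : Module.End R ((ℕ → ℕ) → R) where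
  toFun f d :=
    if Addable m i d then f (addBox i d) else if Removable m i d then β * f d else 0
  map_add' f g := by
    ext d
    simp only [Pi.add_apply]
    split_ifs <;> ring
  map_smul' r f := by
    ext d
    simp only [Pi.smul_apply, smul_eq_mul, RingHom.id_apply]
    split_ifs <;> ring

theorem boxOp_of_addable (β : R) {m d : ℕ → ℕ} {i : ℕ} (h : Addable m i d) (f : (ℕ → ℕ) → R) :
    boxOp β m i f d = f (addBox i d) := if_pos h

theorem boxOp_of_removable (β : R) {m d : ℕ → ℕ} {i : ℕ} (h : Removable m i d)
    (f : (ℕ → ℕ) → R) : boxOp β m i f d = β * f d := by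
  simp only [boxOp, LinearMap.coe_mk, AddHom.coe_mk]
  rw [if_neg (fun h' => h'.not_removable h), if_pos h]

theorem boxOp_of_not (β : R) {m d : ℕ → ℕ} {i : ℕ} (h : ¬ Addable m i d)
    (h' : ¬ Removable m i d) (f : (ℕ → ℕ) → R) : boxOp β m i f d = 0 := by
  simp only [boxOp, LinearMap.coe_mk, AddHom.coe_mk]
  rw [if_neg h, if_neg h']

/-- `boxOp β m i` kills functions vanishing on the shapes with a removable corner of content `i`. -/
theorem boxOp_apply_eq_zero (β : R) {m : ℕ → ℕ} {i : ℕ} {f : (ℕ → ℕ) → R}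
    (h : ∀ d, Removable m i d → f d = 0) : boxOp β m i f = 0 := by
  ext d
  by_cases h1 : Addable m i d
  · rw [boxOp_of_addable β h1, h _ h1.removable_addBox, Pi.zero_apply]
  by_cases h2 : Removable m i d
  · rw [boxOp_of_removable β h2, h _ h2, mul_zero, Pi.zero_apply]
  · rw [boxOp_of_not β h1 h2, Pi.zero_apply]

/-- Evaluated at a shape, the leftmost operator acts first and leaves a removable corner. Adding a
box on just one neighbouring diagonal makes that corner neither removable nor addable, which gives
the two cubic relations. Diagonal 0 has a single neighbour, hence no relation for `u 0 * u 1 * u 0`.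
-/
theorem boxOp_relations (β : R) (m : ℕ → ℕ) : BoxRelations β (boxOp β m) where
  sq i := by
    ext f d
    simp only [Module.End.mul_apply, LinearMap.smul_apply, Pi.smul_apply, smul_eq_mul]
    by_cases h1 : Addable m i d
    · rw [boxOp_of_addable β h1, boxOp_of_addable β h1, boxOp_of_removable β h1.removable_addBox]
    by_cases h2 : Removable m i d
    · rw [boxOp_of_removable β h2]
    · rw [boxOp_of_not β h1 h2, boxOp_of_not β h1 h2, mul_zero]
  comm i j hij := by
    ext f d
    simp only [Module.End.mul_apply]
    have a1 := addable_addBox_iff (m := m) (d := d) (Or.inl hij)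
    have a2 := addable_addBox_iff (m := m) (d := d) (Or.inr hij : j + 1 < i ∨ i + 1 < j)
    have r1 := removable_addBox_iff (m := m) (d := d) (Or.inl hij)
    have r2 := removable_addBox_iff (m := m) (d := d) (Or.inr hij : j + 1 < i ∨ i + 1 < j)
    have c := addBox_comm (show i ≠ j by omega) d
    simp only [boxOp, LinearMap.coe_mk, AddHom.coe_mk, a1, a2, r1, r2, c]
    split_ifs <;> first | rfl | (exfalso; tauto) | ring
  up_down i := by
    ext1 f
    simp only [Module.End.mul_apply, LinearMap.zero_apply]
    refine boxOp_apply_eq_zero β fun d hd => ?_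
    obtain ⟨h1, h2, -⟩ := hd
    rw [show i + 1 + 1 = i + 2 from rfl] at h2
    have h1 := h1 i rfl
    by_cases ha : Addable m (i + 2) d
    · rw [boxOp_of_addable β ha]
      refine boxOp_of_not β (fun h => ?_) (fun h => ?_) f
      · have := h.1 i rfl
        simp only [addBox_apply] at this
        split_ifs at this <;> omega
      · have := h.2.1
        rw [show i + 1 + 1 = i + 2 from rfl] at this
        simp only [addBox_apply] at this
        split_ifs at this <;> omega
    · refine boxOp_of_not β ha (fun h => ?_) _
      have := h.1 (i + 1) rfl
      omega
  down_up i := by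
    ext1 f
    simp only [Module.End.mul_apply, LinearMap.zero_apply]
    refine boxOp_apply_eq_zero β fun d hd => ?_
    obtain ⟨h1, h2, -⟩ := hd
    have h1 := h1 i rfl
    by_cases ha : Addable m i d
    · rw [boxOp_of_addable β ha]
      refine boxOp_of_not β (fun h => ?_) (fun h => ?_) f
      · have := h.2.1
        simp only [addBox_apply] at this
        split_ifs at this <;> omega
      · have := h.1 i rfl
        simp only [addBox_apply] at this
        split_ifs at this <;> omega
    · refine boxOp_of_not β ha (fun h => ?_) _
      have := h.2.1
      omega

/-- The product of the factors `1 + z_a u_{ct a}` over a list, its last letter leftmost. -/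
noncomputable def opProd {α : Type*} (β : R) (ct : α → ℕ) (m : ℕ → ℕ) (z : α → R) :
    List α → Module.End R ((ℕ → ℕ) → R)
  | [] => 1
  | a :: l => opProd β ct m z l * hFactor (boxOp β m) (ct a) (z a)

theorem opProd_append {α : Type*} {ct : α → ℕ} {m : ℕ → ℕ} (β : R) (z : α → R) (l l' : List α) :
    opProd β ct m z (l ++ l') = opProd β ct m z l' * opProd β ct m z l := by
  induction l with
  | nil => simp [opProd]
  | cons a l ih => rw [List.cons_append, opProd, opProd, ih, mul_assoc]

end Operators

end ShiftedK

namespace ShiftedK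

/-! ### Tableaux built letter by letter -/

section Tableaux

/-- The lengths of the diagonals of a shifted shape. -/
def IsShape (d : ℕ → ℕ) : Prop := ∀ i, d (i + 1) ≤ d i ∧ d i ≤ d (i + 1) + 1

theorem IsShape.antitone {d : ℕ → ℕ} (h : IsShape d) : Antitone d :=
  antitone_nat_of_succ_le fun i => (h i).1

theorem IsShape.monotone_add {d : ℕ → ℕ} (h : IsShape d) : Monotone fun i => d i + i :=
  monotone_nat_of_le_succ fun i => by have := (h i).2; omega

variable {α : Type*} [LinearOrder α]

/-- A shifted set-valued tableau with diagonal lengths `d / m`, encoded as the set of its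
entries. An entry `(a, r)` lies in row `r`, on the diagonal of content `ct a`; the order of `α` is
the reading order of the entries, in which a tableau strictly increases. -/
structure IsTab (ct : α → ℕ) (m : ℕ → ℕ) (l : List α) (d : ℕ → ℕ) (E : Finset (α × ℕ)) : Prop where
  le : ∀ i, m i ≤ d i
  shape : IsShape d
  mem : ∀ p ∈ E, p.1 ∈ l
  fill : ∀ i r, (m i ≤ r ∧ r < d i) ↔ ∃ p ∈ E, ct p.1 = i ∧ p.2 = r
  row : ∀ p ∈ E, ∀ q ∈ E, p.2 = q.2 → ct p.1 < ct q.1 → p.1 < q.1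
  col : ∀ p ∈ E, ∀ q ∈ E, p.2 + ct p.1 = q.2 + ct q.1 → p.2 < q.2 → p.1 < q.1

variable {ct : α → ℕ} {m d d' : ℕ → ℕ} {l : List α} {a : α} {E : Finset (α × ℕ)}

theorem IsTab.lt (h : IsTab ct m l d E) {p : α × ℕ} (hp : p ∈ E) : p.2 < d (ct p.1) :=
  ((h.fill _ _).2 ⟨p, hp, rfl, rfl⟩).2

theorem IsTab.le_row (h : IsTab ct m l d E) {p : α × ℕ} (hp : p ∈ E) : m (ct p.1) ≤ p.2 :=
  ((h.fill _ _).2 ⟨p, hp, rfl, rfl⟩).1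

theorem IsTab.shape_unique (h : IsTab ct m l d E) (h' : IsTab ct m l d' E) : d = d' := by
  ext i
  have h1 := fun r => (h.fill i r).trans (h'.fill i r).symm
  have := h1 (d i)
  have := h1 (d' i)
  have := h.le i
  have := h'.le i
  omega

theorem isTab_nil_iff (hm : IsShape m) : IsTab ct m [] d E ↔ d = m ∧ E = ∅ := by
  constructor
  · intro h
    have hE : E = ∅ := Finset.eq_empty_of_forall_notMem fun p hp => by simpa using h.mem p hp
    refine ⟨funext fun i => ?_, hE⟩
    have := h.le i
    by_contra hne
    obtain ⟨p, hp, -⟩ := (h.fill i (m i)).1 ⟨le_rfl, by omega⟩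
    simp [hE] at hp
  · rintro ⟨rfl, rfl⟩
    exact ⟨fun _ => le_rfl, hm, by simp, by simp, by simp, by simp⟩

theorem IsTab.cons (h : IsTab ct m l d E) : IsTab ct m (a :: l) d E :=
  ⟨h.le, h.shape, fun p hp => List.mem_cons_of_mem _ (h.mem p hp), h.fill, h.row, h.col⟩

/-- Inserting a largest letter at a corner. -/
theorem IsTab.insert_corner (h : IsTab ct m l d' E) (ha : ∀ b ∈ l, b < a)
    (hle : ∀ i, d' i ≤ d i) (hd : IsShape d) (hr : Removable m (ct a) d)
    (hfill : ∀ i r, (m i ≤ r ∧ r < d i) ↔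
      (∃ p ∈ E, ct p.1 = i ∧ p.2 = r) ∨ (i = ct a ∧ r = d i - 1)) :
    IsTab ct m (a :: l) d (insert (a, d (ct a) - 1) E) where
  le i := (h.le i).trans (hle i)
  shape := hd
  mem p hp := by
    rcases Finset.mem_insert.1 hp with rfl | hp
    · exact List.mem_cons_self
    · exact List.mem_cons_of_mem _ (h.mem p hp)
  fill i r := by
    rw [hfill]
    simp only [Finset.mem_insert, exists_eq_or_imp]
    grind
  row p hp q hq h1 h2 := by
    obtain ⟨hr1, hr2, hr3⟩ := hr
    rcases Finset.mem_insert.1 hp with rfl | hp <;> rcases Finset.mem_insert.1 hq with rfl | hq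
    · exact absurd h2 (lt_irrefl _)
    -- The new box is a corner of `d`, so no box follows it in its row; the same case of `col` uses
    -- that none lies below it.
    · have := (h.lt hq).trans_le (hle _)
      have := hd.antitone h2
      simp only [Nat.succ_eq_add_one] at *
      omega
    · exact ha _ (h.mem p hp)
    · exact h.row p hp q hq h1 h2
  col p hp q hq h1 h2 := by
    obtain ⟨hr1, hr2, hr3⟩ := hr
    rcases Finset.mem_insert.1 hp with rfl | hp <;> rcases Finset.mem_insert.1 hq with rfl | hq
    · exact absurd h2 (lt_irrefl _)
    · have := (h.lt hq).trans_le (hle _)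
      simp only at h1 h2
      have h3 := hd.monotone_add (show ct q.1 ≤ ct a - 1 by omega)
      have h4 := hr1 (ct a - 1) (by omega)
      simp only at h3
      omega
    · exact ha _ (h.mem p hp)
    · exact h.col p hp q hq h1 h2

theorem IsShape.addBox (hd : IsShape d) {i : ℕ} (h : Addable m i d) : IsShape (addBox i d) := by
  intro j
  obtain ⟨h1, h2, -⟩ := h
  have h3 := hd j
  have h4 := h1 j
  simp only [addBox_apply]
  split_ifs with h5 h6 h6
  · omega
  · subst h5
    have := h4 rfl
    omega
  · subst h6
    omega
  · exact h3

theorem IsTab.insert_of_addable (h : IsTab ct m l d E) (ha : ∀ b ∈ l, b < a)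
    (hd : Addable m (ct a) d) :
    IsTab ct m (a :: l) (addBox (ct a) d) (insert (a, d (ct a)) E) := by
  have e : addBox (ct a) d (ct a) = d (ct a) + 1 := by rw [addBox_apply, if_pos rfl]
  have := h.insert_corner (a := a) (d := addBox (ct a) d) ha (fun i => ?_) (h.shape.addBox hd)
    hd.removable_addBox ?_
  · rwa [e, Nat.add_sub_cancel] at this
  · rw [addBox_apply]
    split_ifs with hi
    · rw [hi]
      omega
    · exact le_rfl
  · intro i r
    rw [← h.fill, addBox_apply]
    split_ifs with hi
    · subst hi
      have := hd.2.2
      omega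
    · simp [hi]

theorem IsTab.insert_of_removable (h : IsTab ct m l d E) (ha : ∀ b ∈ l, b < a)
    (hd : Removable m (ct a) d) :
    IsTab ct m (a :: l) d (insert (a, d (ct a) - 1) E) := by
  refine h.insert_corner ha (fun i => le_rfl) h.shape hd fun i r => ?_
  rw [← h.fill]
  refine ⟨Or.inl, ?_⟩
  rintro (h1 | ⟨rfl, rfl⟩)
  · exact h1
  · have := hd.2.2
    omega

/-- A largest letter lies in a removable corner. -/
theorem IsTab.corner (hm : IsShape m) (h : IsTab ct m (a :: l) d E) (ha : ∀ b ∈ l, b < a) {r : ℕ}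
    (hr : (a, r) ∈ E) : Removable m (ct a) d ∧ r = d (ct a) - 1 := by
  have hmax : ∀ q ∈ E, ¬ a < q.1 := fun q hq => by
    rcases List.mem_cons.1 (h.mem q hq) with hq | hq
    · rw [hq]
      exact lt_irrefl a
    · exact (ha _ hq).not_gt
  have h1 : r < d (ct a) := h.lt hr
  have h2 : m (ct a) ≤ r := h.le_row hr
  -- Otherwise the box to the right lies in the diagram and carries a letter larger than `a`. The
  -- bound `h4` excludes the box below in the same way.
  have h3 : d (ct a + 1) ≤ r := by
    by_contra hlt
    obtain ⟨q, hq, hq1, hq2⟩ := (h.fill (ct a + 1) r).1 ⟨(hm _).1.trans h2, by omega⟩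
    exact hmax q hq (h.row _ hr q hq hq2.symm (by simp [hq1]))
  have h4 : ∀ j, j + 1 = ct a → d j ≤ r + 1 := fun j hj => by
    by_contra hlt
    have := (hm j).2
    rw [hj] at this
    obtain ⟨q, hq, hq1, hq2⟩ := (h.fill j (r + 1)).1 ⟨by omega, by omega⟩
    exact hmax q hq (h.col _ hr q hq (by simp only; omega) (by simp only; omega))
  have h5 := (h.shape (ct a)).2
  refine ⟨⟨fun j hj => ?_, by omega, by omega⟩, by omega⟩
  have h6 := (h.shape j).1
  have := h4 j hj
  rw [hj] at h6
  omega

/-- The largest letter is either absent, or shares its corner with smaller letters, or is alone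
there. In the last case deleting it also deletes the box. These are the terms `1`, `β` and "add a
box" of `1 + z u_i`. -/
theorem isTab_cons_iff (hm : IsShape m) (ha : ∀ b ∈ l, b < a) :
    IsTab ct m (a :: l) d E ↔ IsTab ct m l d E ∨
      (∃ E', Removable m (ct a) d ∧ IsTab ct m l d E' ∧ E = insert (a, d (ct a) - 1) E') ∨
      ∃ d' E', Addable m (ct a) d' ∧ IsTab ct m l d' E' ∧ d = addBox (ct a) d' ∧
        E = insert (a, d' (ct a)) E' := by
  constructor
  · intro h
    by_cases hE : ∃ r, (a, r) ∈ E
    · obtain ⟨r, hr⟩ := hE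
      obtain ⟨hR, rfl⟩ := h.corner hm ha hr
      -- All copies of `a` sit in one and the same corner, so erasing one entry erases the letter.
      have hmem : ∀ p ∈ E.erase (a, d (ct a) - 1), p.1 ∈ l := fun p hp => by
        obtain ⟨hp1, hp2⟩ := Finset.mem_erase.1 hp
        refine (List.mem_cons.1 (h.mem p hp2)).resolve_left fun hpa => hp1 ?_
        obtain ⟨b, s⟩ := p
        obtain rfl : b = a := hpa
        rw [(h.corner hm ha hp2).2]
      have hrow : ∀ p ∈ E.erase (a, d (ct a) - 1), ∀ q ∈ E.erase (a, d (ct a) - 1), p.2 = q.2 →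
          ct p.1 < ct q.1 → p.1 < q.1 := fun p hp q hq =>
        h.row p (Finset.mem_of_mem_erase hp) q (Finset.mem_of_mem_erase hq)
      have hcol : ∀ p ∈ E.erase (a, d (ct a) - 1), ∀ q ∈ E.erase (a, d (ct a) - 1),
          p.2 + ct p.1 = q.2 + ct q.1 → p.2 < q.2 → p.1 < q.1 := fun p hp q hq =>
        h.col p (Finset.mem_of_mem_erase hp) q (Finset.mem_of_mem_erase hq)
      -- Does the corner still hold an entry once `a` is erased?
      by_cases hp : ∃ p ∈ E.erase (a, d (ct a) - 1), ct p.1 = ct a ∧ p.2 = d (ct a) - 1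
      · refine Or.inr (Or.inl ⟨E.erase (a, d (ct a) - 1), hR,
          ⟨h.le, h.shape, hmem, fun i s => ?_, hrow, hcol⟩, (Finset.insert_erase hr).symm⟩)
        rw [h.fill]
        constructor
        · rintro ⟨q, hq, hq1, hq2⟩
          by_cases hqa : q = (a, d (ct a) - 1)
          · subst hqa
            rw [← hq1, ← hq2]
            exact hp
          · exact ⟨q, Finset.mem_erase.2 ⟨hqa, hq⟩, hq1, hq2⟩
        · rintro ⟨q, hq, hq1⟩
          exact ⟨q, Finset.mem_of_mem_erase hq, hq1⟩
      · obtain ⟨hR1, hR2, hR3⟩ := hR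
        have e : ∀ j, Function.update d (ct a) (d (ct a) - 1) j =
            if j = ct a then d (ct a) - 1 else d j := fun j => Function.update_apply ..
        refine Or.inr (Or.inr ⟨Function.update d (ct a) (d (ct a) - 1), E.erase (a, d (ct a) - 1),
          ⟨fun j hj => ?_, ?_, ?_⟩, ⟨fun i => ?_, fun i => ?_, hmem, fun i s => ?_, hrow, hcol⟩,
          ?_, ?_⟩)
        · rw [e, e, if_neg (by omega), if_pos rfl, hR1 j hj]
          omega
        · rw [e, e, if_neg (by omega), if_pos rfl]
          omega
        · rw [e, if_pos rfl]
          omega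
        · rw [e]
          have := h.le i
          split_ifs with hi
          · subst hi
            omega
          · exact this
        · rw [e, e]
          have h1 := h.shape i
          have h2 := hR1 i
          split_ifs with h3 h4 h4
          · omega
          · have := h2 h3
            rw [h3] at h1
            omega
          · subst h4
            omega
          · exact h1
        · have h1 := h.fill i s
          rw [e]
          split_ifs with hi
          · subst hi
            constructor
            · rintro ⟨hs1, hs2⟩
              obtain ⟨q, hq, hq1, hq2⟩ := h1.1 ⟨hs1, by omega⟩
              refine ⟨q, Finset.mem_erase.2 ⟨?_, hq⟩, hq1, hq2⟩
              rintro rfl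
              simp only at hq2
              omega
            · rintro ⟨q, hq, hq1, hq2⟩
              have h3 := h1.2 ⟨q, Finset.mem_of_mem_erase hq, hq1, hq2⟩
              have : s ≠ d (ct a) - 1 := fun hs => hp ⟨q, hq, hq1, hq2.trans hs⟩
              omega
          · rw [h1]
            constructor
            · rintro ⟨q, hq, hq1, hq2⟩
              refine ⟨q, Finset.mem_erase.2 ⟨?_, hq⟩, hq1, hq2⟩
              rintro rfl
              exact hi hq1.symm
            · rintro ⟨q, hq, hq1⟩
              exact ⟨q, Finset.mem_of_mem_erase hq, hq1⟩
        · ext j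
          rw [addBox_apply, e, if_pos rfl, e]
          split_ifs with hj
          · rw [hj]
            omega
          · rfl
        · rw [e, if_pos rfl, Finset.insert_erase hr]
    · refine Or.inl ⟨h.le, h.shape, fun p hp => ?_, h.fill, h.row, h.col⟩
      refine (List.mem_cons.1 (h.mem p hp)).resolve_left fun hpa => hE ⟨p.2, ?_⟩
      rw [← hpa]
      exact hp
  · rintro (h | ⟨E', hR, hT, rfl⟩ | ⟨d', E', hA, hT, rfl, rfl⟩)
    · exact h.cons
    · exact hT.insert_of_removable ha hR
    · exact hT.insert_of_addable ha hA

open Classical in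
/-- Inserting the letter `a` at the end of its diagonal. -/
noncomputable def insertLetter (ct : α → ℕ) (m : ℕ → ℕ) (a : α)
    (x : (ℕ → ℕ) × Finset (α × ℕ)) : (ℕ → ℕ) × Finset (α × ℕ) :=
  if Addable m (ct a) x.1 then (addBox (ct a) x.1, insert (a, x.1 (ct a)) x.2)
  else (x.1, insert (a, x.1 (ct a) - 1) x.2)

open Classical in
/-- All tableaux with letters in a decreasing list, together with their shapes. -/
noncomputable def tabs (ct : α → ℕ) (m : ℕ → ℕ) : List α → Finset ((ℕ → ℕ) × Finset (α × ℕ))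
  | [] => {(m, ∅)}
  | a :: l => tabs ct m l ∪ ((tabs ct m l).filter fun x =>
      Addable m (ct a) x.1 ∨ Removable m (ct a) x.1).image (insertLetter ct m a)

theorem mem_tabs (hm : IsShape m) (hl : l.Pairwise (· > ·)) :
    (d, E) ∈ tabs ct m l ↔ IsTab ct m l d E := by
  induction l generalizing d E with
  | nil => simp [tabs, isTab_nil_iff hm]
  | cons a l ih =>
    rw [List.pairwise_cons] at hl
    classical
    rw [isTab_cons_iff hm hl.1, tabs, Finset.mem_union, ih hl.2]
    refine or_congr Iff.rfl ?_
    simp only [Finset.mem_image, Finset.mem_filter, Prod.exists, ih hl.2]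
    constructor
    · rintro ⟨d', E', ⟨hT, h⟩, he⟩
      rw [insertLetter] at he
      split_ifs at he with hA
      · obtain ⟨rfl, rfl⟩ := Prod.mk.inj he
        exact Or.inr ⟨d', E', hA, hT, rfl, rfl⟩
      · obtain ⟨rfl, rfl⟩ := Prod.mk.inj he
        exact Or.inl ⟨E', h.resolve_left hA, hT, rfl⟩
    · rintro (⟨E', hR, hT, rfl⟩ | ⟨d', E', hA, hT, rfl, rfl⟩)
      · exact ⟨d, E', ⟨hT, Or.inr hR⟩, if_neg fun h => h.not_removable hR⟩
      · exact ⟨d', E', ⟨hT, Or.inl hA⟩, if_pos hA⟩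

variable {R : Type*} [CommRing R]

/-- The number of entries of a tableau minus the number of its boxes. -/
def excess (ct : α → ℕ) (E : Finset (α × ℕ)) : ℕ :=
  E.card - (E.image fun p => (ct p.1, p.2)).card

/-- The weight of a tableau. -/
def tabWeight (β : R) (ct : α → ℕ) (z : α → R) (E : Finset (α × ℕ)) : R :=
  β ^ excess ct E * ∏ p ∈ E, z p.1

theorem tabWeight_insert_of_notMem (β : R) (z : α → R) {r : ℕ}
    (h : ∀ p ∈ E, ¬ (ct p.1 = ct a ∧ p.2 = r)) :
    tabWeight β ct z (insert (a, r) E) = z a * tabWeight β ct z E := by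
  have h1 : (a, r) ∉ E := fun h' => h _ h' ⟨rfl, rfl⟩
  have h2 : (ct a, r) ∉ E.image fun p => (ct p.1, p.2) := by
    intro h'
    obtain ⟨p, hp, he⟩ := Finset.mem_image.1 h'
    exact h p hp (Prod.mk.inj he)
  rw [tabWeight, tabWeight, excess, excess, Finset.image_insert, Finset.card_insert_of_notMem h1,
    Finset.card_insert_of_notMem h2, Finset.prod_insert h1, Nat.add_sub_add_right]
  ring

theorem tabWeight_insert_of_mem (β : R) (z : α → R) {r : ℕ} (h1 : (a, r) ∉ E)
    (h : ∃ p ∈ E, ct p.1 = ct a ∧ p.2 = r) :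
    tabWeight β ct z (insert (a, r) E) = β * (z a * tabWeight β ct z E) := by
  have h2 : (ct a, r) ∈ E.image fun p => (ct p.1, p.2) := by
    obtain ⟨p, hp, he1, he2⟩ := h
    exact Finset.mem_image.2 ⟨p, hp, by rw [he1, he2]⟩
  -- This keeps the truncated subtraction in `excess` exact.
  have h3 : (E.image fun p => (ct p.1, p.2)).card ≤ E.card := Finset.card_image_le
  rw [tabWeight, tabWeight, excess, excess, Finset.image_insert, Finset.card_insert_of_notMem h1,
    Finset.insert_eq_of_mem h2, Finset.prod_insert h1, Nat.sub_add_comm h3]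
  ring

/-- The generating function of tableaux, as a product of box-adding operators. -/
theorem opProd_apply (hm : IsShape m) (hl : l.Pairwise (· > ·)) (β : R) (z : α → R)
    (f : (ℕ → ℕ) → R) :
    opProd β ct m z l f m = ∑ x ∈ tabs ct m l, tabWeight β ct z x.2 * f x.1 := by
  classical
  induction l generalizing f with
  | nil => simp [opProd, tabs, tabWeight, excess]
  | cons a l ih =>
    have hl' := List.pairwise_cons.1 hl
    have hlt : ∀ {x : (ℕ → ℕ) × Finset (α × ℕ)}, x ∈ tabs ct m l → ∀ r, (a, r) ∉ x.2 :=
      fun hx r hr => lt_irrefl a (hl'.1 _ (((mem_tabs hm hl'.2).1 hx).mem _ hr))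
    have hins : ∀ x, ∃ r, (insertLetter ct m a x).2 = insert (a, r) x.2 := fun x => by
      rw [insertLetter]
      split_ifs
      · exact ⟨_, rfl⟩
      · exact ⟨_, rfl⟩
    have hdisj : Disjoint (tabs ct m l) (((tabs ct m l).filter fun x =>
        Addable m (ct a) x.1 ∨ Removable m (ct a) x.1).image (insertLetter ct m a)) := by
      rw [Finset.disjoint_left]
      intro x hx hx'
      obtain ⟨y, -, rfl⟩ := Finset.mem_image.1 hx'
      obtain ⟨r, hr⟩ := hins y
      exact hlt hx r (by rw [hr]; exact Finset.mem_insert_self _ _)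
    -- Deleting the letter `a` undoes the insertion on entries, and the entries determine the shape;
    -- hence injectivity.
    have herase : ∀ x ∈ tabs ct m l,
        (insertLetter ct m a x).2.filter (fun p => p.1 ≠ a) = x.2 := by
      intro x hx
      obtain ⟨r, hr⟩ := hins x
      rw [hr, Finset.filter_insert, if_neg (by simp), Finset.filter_eq_self]
      rintro ⟨b, s⟩ hp rfl
      exact hlt hx s hp
    have hinj : Set.InjOn (insertLetter ct m a) ((tabs ct m l).filter fun x =>
        Addable m (ct a) x.1 ∨ Removable m (ct a) x.1 : Finset _) := by
      intro x hx y hy hxy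
      have hx' := (Finset.mem_filter.1 (Finset.mem_coe.1 hx)).1
      have hy' := (Finset.mem_filter.1 (Finset.mem_coe.1 hy)).1
      have h2 : x.2 = y.2 := by rw [← herase x hx', ← herase y hy', hxy]
      have h1 := (mem_tabs hm hl'.2).1 hx'
      rw [h2] at h1
      exact Prod.ext (h1.shape_unique ((mem_tabs hm hl'.2).1 hy')) h2
    rw [opProd, Module.End.mul_apply, ih hl'.2, tabs, Finset.sum_union hdisj, Finset.sum_image hinj,
      Finset.sum_filter, ← Finset.sum_add_distrib]
    refine Finset.sum_congr rfl fun x hx => ?_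
    have hT := (mem_tabs hm hl'.2).1 hx
    simp only [hFactor, LinearMap.add_apply, Module.End.one_apply, LinearMap.smul_apply,
      Pi.add_apply, Pi.smul_apply, smul_eq_mul, mul_add]
    congr 1
    by_cases hA : Addable m (ct a) x.1
    · rw [if_pos (Or.inl hA), boxOp_of_addable β hA, insertLetter, if_pos hA,
        tabWeight_insert_of_notMem]
      · ring
      · rintro p hp ⟨h1, h2⟩
        have := hT.lt hp
        rw [h1, h2] at this
        exact lt_irrefl _ this
    by_cases hR : Removable m (ct a) x.1
    · rw [if_pos (Or.inr hR), boxOp_of_removable β hR, insertLetter, if_neg hA,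
        tabWeight_insert_of_mem β z (hlt hx _)]
      · ring
      · have := hR.2.2
        exact (hT.fill (ct a) (x.1 (ct a) - 1)).1 ⟨by omega, by omega⟩
    · rw [if_neg (by tauto), boxOp_of_not β hA hR]
      ring

end Tableaux

end ShiftedK

namespace ShiftedK

/-! ### Strict partitions and their diagonal lengths -/

section Diagonals

theorem StrictPartition.exists_parts_le (lam : StrictPartition) (i : ℕ) :
    ∃ r, lam.parts r ≤ i := by
  refine ⟨lam.parts 0 + 1, ?_⟩
  have := lam.add_le (lam.parts 0 + 1)
  by_contra h
  have := this (by omega)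
  omega

/-- The number of boxes of content `i` in the shifted diagram of `λ`. -/
def StrictPartition.diag (lam : StrictPartition) (i : ℕ) : ℕ := Nat.find (lam.exists_parts_le i)

/-- Row `r` starts on the main diagonal, so its contents are those below `lam.parts r`. -/
theorem StrictPartition.lt_diag_iff (lam : StrictPartition) {i r : ℕ} :
    r < lam.diag i ↔ i < lam.parts r := by
  rw [diag, Nat.lt_find_iff]
  constructor
  · intro h
    have := h r le_rfl
    omega
  · intro h s hs
    have := lam.antitone hs
    omega

/-- The drop from diagonal `i` to `i + 1` counts the rows of length `i + 1`. There is at most one,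
as nonzero parts are distinct. -/
theorem StrictPartition.isShape_diag (lam : StrictPartition) : IsShape lam.diag := by
  intro i
  constructor
  · refine le_of_forall_lt fun r hr => ?_
    rw [lam.lt_diag_iff] at hr ⊢
    omega
  · by_contra h
    have h1 : lam.diag (i + 1) + 1 < lam.diag i := by omega
    rw [lam.lt_diag_iff] at h1
    have h2 : ¬ lam.diag (i + 1) < lam.diag (i + 1) := lt_irrefl _
    rw [lam.lt_diag_iff] at h2
    have h4 := lam.antitone (Nat.le_succ (lam.diag (i + 1)))
    rw [Nat.succ_eq_add_one] at h4
    have h3 := lam.strict (lam.diag (i + 1)) (by omega)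
    omega

theorem StrictPartition.diag_mono {lam mu : StrictPartition} (h : mu ⊆ lam) (i : ℕ) :
    mu.diag i ≤ lam.diag i := by
  refine le_of_forall_lt fun r hr => ?_
  rw [StrictPartition.lt_diag_iff] at hr ⊢
  exact hr.trans_le (h r)

variable {lam mu : StrictPartition}

/-- The content of a box. -/
def content (c : SD lam mu) : ℕ := c.1.2 - c.1.1

theorem row_add_content (c : SD lam mu) : c.1.1 + content c = c.1.2 := by
  obtain ⟨j, hj, -⟩ := c.2
  rw [content]
  omega

theorem mem_SD_iff {i r : ℕ} : (r, r + i) ∈ SD lam mu ↔ mu.diag i ≤ r ∧ r < lam.diag i := by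
  rw [lam.lt_diag_iff, ← not_lt, mu.lt_diag_iff, not_lt]
  constructor
  · rintro ⟨j, h1, h2⟩
    simp only [Nat.add_left_cancel_iff] at h1
    rwa [h1]
  · intro h
    exact ⟨i, rfl, h⟩

theorem diag_content (c : SD lam mu) :
    mu.diag (content c) ≤ c.1.1 ∧ c.1.1 < lam.diag (content c) := by
  rw [← mem_SD_iff, row_add_content]
  exact c.2

theorem box_ext {c d : SD lam mu} (h1 : c.1.1 = d.1.1) (h2 : content c = content d) : c = d :=
  Subtype.ext (Prod.ext h1 (by rw [← row_add_content, ← row_add_content, h1, h2]))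

theorem content_lt (c : SD lam mu) : content c < lam.parts 0 :=
  (lam.lt_diag_iff.1 (diag_content c).2).trans_le (lam.antitone (Nat.zero_le _))

end Diagonals

/-! ### The reading order on marked letters -/

section Letters

/-- Marked numbers together with a content, in reading order: `(k, i)` is the unprimed and
`(k, -i-1)` the primed number of index `k` on the diagonal of content `i`. -/
abbrev Letter : Type := ℕ ×ₗ ℤ

namespace Letter

/-- The index of the variable of a letter. -/
def idx (a : Letter) : ℕ := (ofLex a).1

/-- The content of a letter. -/
def ct (a : Letter) : ℕ := match (ofLex a).2 with
  | Int.ofNat n => n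
  | Int.negSucc n => n

/-- The marked number of a letter. -/
def mark (a : Letter) : Marked := match (ofLex a).2 with
  | Int.ofNat _ => toLex (idx a, true)
  | Int.negSucc _ => toLex (idx a, false)

/-- The letter of a marked number on a diagonal. -/
def enc (m : Marked) (i : ℕ) : Letter :=
  toLex (m.abs, if (ofLex m).2 then Int.ofNat i else Int.negSucc i)

/-- The letter is primed and lies on the main diagonal. -/
def IsDiagPrimed (a : Letter) : Prop := (ofLex a).2 = -1

theorem ct_enc (m : Marked) (i : ℕ) : ct (enc m i) = i := by
  obtain ⟨k, b⟩ := m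
  cases b <;> rfl

theorem mark_enc (m : Marked) (i : ℕ) : mark (enc m i) = m := by
  obtain ⟨k, b⟩ := m
  cases b <;> rfl

theorem enc_mark (a : Letter) : enc (mark a) (ct a) = a := by
  obtain ⟨k, s⟩ := a
  cases s <;> rfl

theorem isDiagPrimed_enc (m : Marked) (i : ℕ) :
    IsDiagPrimed (enc m i) ↔ m.IsPrimed ∧ i = 0 := by
  obtain ⟨k, b⟩ := m
  cases b
  · change Int.negSucc i = -1 ↔ false = false ∧ i = 0
    rw [Int.negSucc_eq]
    simp only [true_and]
    omega
  · change Int.ofNat i = -1 ↔ true = false ∧ i = 0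
    simp only [Int.ofNat_eq_natCast, Bool.true_eq_false, false_and, iff_false]
    omega

/-- Contents increase along a row. Unprimed letters are ordered by increasing and primed ones by
decreasing content, so strict increase of letters encodes the row condition: weak increase with only
unprimed repetitions. -/
theorem enc_lt_of_lt {m m' : Marked} {i j : ℕ} (h : i < j) :
    enc m i < enc m' j ↔ m < m' ∨ (m = m' ∧ m.IsUnprimed) := by
  obtain ⟨k, b⟩ := m
  obtain ⟨k', b'⟩ := m'
  change toLex (k, if b then Int.ofNat i else Int.negSucc i) <
    toLex (k', if b' then Int.ofNat j else Int.negSucc j) ↔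
    toLex (k, b) < toLex (k', b') ∨ (toLex (k, b) = toLex (k', b') ∧ b = true)
  rw [Prod.Lex.toLex_lt_toLex, Prod.Lex.toLex_lt_toLex, toLex_inj, Prod.mk.injEq]
  rcases lt_trichotomy k k' with hk | rfl | hk
  · simp [hk]
  · cases b <;> cases b' <;> simp [Int.negSucc_eq, Bool.lt_iff] <;> omega
  · simp [hk.not_gt, hk.ne']

/-- The counterpart for columns, where contents decrease downwards and only primed numbers may
repeat. -/
theorem enc_lt_of_gt {m m' : Marked} {i j : ℕ} (h : j < i) :
    enc m i < enc m' j ↔ m < m' ∨ (m = m' ∧ m.IsPrimed) := by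
  obtain ⟨k, b⟩ := m
  obtain ⟨k', b'⟩ := m'
  change toLex (k, if b then Int.ofNat i else Int.negSucc i) <
    toLex (k', if b' then Int.ofNat j else Int.negSucc j) ↔
    toLex (k, b) < toLex (k', b') ∨ (toLex (k, b) = toLex (k', b') ∧ b = false)
  rw [Prod.Lex.toLex_lt_toLex, Prod.Lex.toLex_lt_toLex, toLex_inj, Prod.mk.injEq]
  rcases lt_trichotomy k k' with hk | rfl | hk
  · simp [hk]
  · cases b <;> cases b' <;> simp [Int.negSucc_eq, Bool.lt_iff] <;> omega
  · simp [hk.not_gt, hk.ne']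

/-- The letters of index `k` and content less than `n`, in decreasing order. -/
def block (k : ℕ) : ℕ → List Letter
  | 0 => []
  | n + 1 => toLex (k, Int.ofNat n) :: (block k n ++ [toLex (k, Int.negSucc n)])

/-- The letters of index less than `N` and content less than `n`, in decreasing order. -/
def alphabet (n : ℕ) : ℕ → List Letter
  | 0 => []
  | N + 1 => block N n ++ alphabet n N

theorem mem_block {k n : ℕ} {a : Letter} : a ∈ block k n ↔ idx a = k ∧ ct a < n := by
  induction n with
  | zero => simp [block]
  | succ n ih =>
    rw [block, List.mem_cons, List.mem_append, List.mem_singleton, ih]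
    obtain ⟨k', s⟩ := a
    change (toLex (k', s) = toLex (k, _) ∨ _ ∨ toLex (k', s) = toLex (k, _)) ↔ _
    rw [toLex_inj, toLex_inj, Prod.mk.injEq, Prod.mk.injEq]
    cases s with
    | ofNat s =>
      change _ ∨ (k' = k ∧ s < n) ∨ _ ↔ k' = k ∧ s < n + 1
      simp only [Int.ofNat_eq_natCast]
      omega
    | negSucc s =>
      change _ ∨ (k' = k ∧ s < n) ∨ _ ↔ k' = k ∧ s < n + 1
      simp only [Int.ofNat_eq_natCast]
      omega

theorem mem_alphabet {n N : ℕ} {a : Letter} : a ∈ alphabet n N ↔ idx a < N ∧ ct a < n := by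
  induction N with
  | zero => simp [alphabet]
  | succ N ih =>
    rw [alphabet, List.mem_append, ih, mem_block]
    omega

theorem pairwise_block (k n : ℕ) : (block k n).Pairwise (· > ·) := by
  induction n with
  | zero => simp [block]
  | succ n ih =>
    have h : ∀ {a}, a ∈ block k n → idx a = k ∧ ct a < n := fun ha => mem_block.1 ha
    rw [block, List.pairwise_cons, List.pairwise_append]
    refine ⟨fun a ha => ?_, ih, List.pairwise_singleton _ _, fun a ha b hb => ?_⟩
    · rw [List.mem_append, List.mem_singleton] at ha
      rcases ha with ha | rfl
      · obtain ⟨h1, h2⟩ := h ha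
        obtain ⟨k', s⟩ := a
        change toLex (k', s) < toLex (k, _)
        rw [Prod.Lex.toLex_lt_toLex]
        refine Or.inr ⟨h1, ?_⟩
        cases s with
        | ofNat s =>
          change s < n at h2
          simp only [Int.ofNat_eq_natCast]
          omega
        | negSucc s =>
          simp only [Int.ofNat_eq_natCast]
          omega
      · change toLex (k, _) < toLex (k, _)
        rw [Prod.Lex.toLex_lt_toLex]
        refine Or.inr ⟨rfl, ?_⟩
        simp only [Int.ofNat_eq_natCast]
        omega
    · rw [List.mem_singleton] at hb
      subst hb
      obtain ⟨h1, h2⟩ := h ha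
      obtain ⟨k', s⟩ := a
      change toLex (k, _) < toLex (k', s)
      rw [Prod.Lex.toLex_lt_toLex]
      refine Or.inr ⟨h1.symm, ?_⟩
      cases s with
      | ofNat s =>
        simp only [Int.ofNat_eq_natCast]
        omega
      | negSucc s =>
        change s < n at h2
        simp only
        omega

theorem pairwise_alphabet (n N : ℕ) : (alphabet n N).Pairwise (· > ·) := by
  induction N with
  | zero => simp [alphabet]
  | succ N ih =>
    rw [alphabet, List.pairwise_append]
    refine ⟨pairwise_block N n, ih, fun a ha b hb => ?_⟩
    have h1 := (mem_block.1 ha).1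
    have h2 := (mem_alphabet.1 hb).1
    change toLex (ofLex b) < toLex (ofLex a)
    rw [Prod.Lex.toLex_lt_toLex]
    left
    change idx b < idx a
    omega

end Letter

end Letters

/-! ### Fillings as sets of entries -/

section Entries

open Letter

variable {lam mu : StrictPartition}

/-- An entry of a filling, as a letter and a row. -/
def entry (x : (_ : SD lam mu) × Marked) : Letter × ℕ := (enc x.2 (content x.1), x.1.1.1)

theorem entry_injective : Function.Injective (entry (lam := lam) (mu := mu)) := by
  rintro ⟨c, m⟩ ⟨c', m'⟩ h
  obtain ⟨h1, h2⟩ := Prod.mk.inj h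
  have h3 : content c = content c' := by
    have := congrArg ct h1
    rwa [ct_enc, ct_enc] at this
  have h4 : m = m' := by
    have := congrArg mark h1
    rwa [mark_enc, mark_enc] at this
  obtain rfl := box_ext h2 h3
  rw [h4]

/-- All entries of a filling. -/
noncomputable def entries (T : Filling lam mu) : Finset (Letter × ℕ) :=
  (Finset.univ.sigma T).map ⟨entry, entry_injective⟩

theorem mem_entries {T : Filling lam mu} {p : Letter × ℕ} :
    p ∈ entries T ↔ ∃ c, ∃ m ∈ T c, (enc m (content c), c.1.1) = p := by
  simp only [entries, Finset.mem_map, Finset.mem_sigma, Finset.mem_univ, true_and,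
    Function.Embedding.coeFn_mk, Sigma.exists, entry]

theorem enc_mem_entries {T : Filling lam mu} {c : SD lam mu} {m : Marked} :
    (enc m (content c), c.1.1) ∈ entries T ↔ m ∈ T c := by
  rw [show (enc m (content c), c.1.1) = entry ⟨c, m⟩ from rfl, entries]
  refine (Finset.mem_map' ⟨entry, entry_injective⟩).trans ?_
  simp

theorem entries_injective : Function.Injective (entries (lam := lam) (mu := mu)) := by
  intro T T' h
  ext c m
  rw [← enc_mem_entries, h, enc_mem_entries]

theorem card_entries (T : Filling lam mu) : (entries T).card = size T := by
  rw [entries, Finset.card_map, Finset.card_sigma, size]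

theorem weight_eq_sum_entries (T : Filling lam mu) :
    weight T = ∑ p ∈ entries T, Finsupp.single (idx p.1) 1 := by
  rw [entries, Finset.sum_map, Finset.sum_sigma, weight]
  rfl

theorem excess_entries {T : Filling lam mu} (hT : ∀ c, (T c).Nonempty) :
    excess ct (entries T) = size T - Fintype.card (SD lam mu) := by
  rw [excess, card_entries]
  congr 1
  have hinj : Function.Injective fun c : SD lam mu => (content c, c.1.1) := fun c d h =>
    box_ext (Prod.mk.inj h).2 (Prod.mk.inj h).1
  rw [← Finset.card_univ, ← Finset.card_image_of_injective _ hinj]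
  congr 1
  ext x
  simp only [Finset.mem_image, Finset.mem_univ, true_and]
  constructor
  · rintro ⟨p, hp, rfl⟩
    obtain ⟨c, m, hm, rfl⟩ := mem_entries.1 hp
    exact ⟨c, by simp only [ct_enc]⟩
  · rintro ⟨c, rfl⟩
    obtain ⟨m, hm⟩ := hT c
    exact ⟨_, enc_mem_entries.2 hm, by simp only [ct_enc]⟩

theorem IsSetSSMT.isTab_entries {T : Filling lam mu} (hT : IsSetSSMT T) (h : mu ⊆ lam)
    {l : List Letter} (hl : ∀ p ∈ entries T, p.1 ∈ l) :
    IsTab ct mu.diag l lam.diag (entries T) where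
  le := StrictPartition.diag_mono h
  shape := lam.isShape_diag
  mem := hl
  fill i r := by
    constructor
    · intro hr
      let c : SD lam mu := ⟨(r, r + i), mem_SD_iff.2 hr⟩
      obtain ⟨m, hm⟩ := hT.nonempty c
      refine ⟨_, enc_mem_entries.2 hm, ?_, rfl⟩
      rw [ct_enc, content]
      exact Nat.add_sub_cancel_left _ _
    · rintro ⟨p, hp, rfl, rfl⟩
      obtain ⟨c, m, hm, rfl⟩ := mem_entries.1 hp
      rw [ct_enc]
      exact diag_content c
  row p hp q hq h1 h2 := by
    obtain ⟨c, m, hm, rfl⟩ := mem_entries.1 hp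
    obtain ⟨c', m', hm', rfl⟩ := mem_entries.1 hq
    simp only [ct_enc] at h1 h2
    have h3 := row_add_content c
    have h4 := row_add_content c'
    rw [enc_lt_of_lt h2]
    refine (hT.row_le c c' h1 (by omega) m hm m' hm').lt_or_eq.imp_right fun he => ⟨he, ?_⟩
    by_contra hu
    exact hT.row_primed c c' h1 (fun hc => h2.ne (congrArg content hc)) m hm
      (Bool.eq_false_iff.2 hu) (he ▸ hm')
  col p hp q hq h1 h2 := by
    obtain ⟨c, m, hm, rfl⟩ := mem_entries.1 hp
    obtain ⟨c', m', hm', rfl⟩ := mem_entries.1 hq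
    simp only [ct_enc] at h1 h2
    have h3 := row_add_content c
    have h4 := row_add_content c'
    rw [enc_lt_of_gt (by omega)]
    refine (hT.col_le c c' (by omega) h2 m hm m' hm').lt_or_eq.imp_right fun he => ⟨he, ?_⟩
    by_contra hu
    exact hT.col_unprimed c c' (by omega) (fun hc => h2.ne (by rw [hc])) m hm
      (Bool.eq_true_of_not_eq_false hu) (he ▸ hm')

theorem isSetSSMT_of_isTab {T : Filling lam mu} {l : List Letter}
    (hE : IsTab ct mu.diag l lam.diag (entries T)) : IsSetSSMT T := by
  have hrow : ∀ c d : SD lam mu, c.1.1 = d.1.1 → c.1.2 < d.1.2 → ∀ m ∈ T c, ∀ m' ∈ T d,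
      m < m' ∨ (m = m' ∧ m.IsUnprimed) := by
    intro c d h1 h2 m hm m' hm'
    have h3 := row_add_content c
    have h4 := row_add_content d
    have h5 : content c < content d := by omega
    rw [← enc_lt_of_lt h5]
    exact hE.row _ (enc_mem_entries.2 hm) _ (enc_mem_entries.2 hm') h1 (by simpa only [ct_enc])
  have hcol : ∀ c d : SD lam mu, c.1.2 = d.1.2 → c.1.1 < d.1.1 → ∀ m ∈ T c, ∀ m' ∈ T d,
      m < m' ∨ (m = m' ∧ m.IsPrimed) := by
    intro c d h1 h2 m hm m' hm'
    have h3 := row_add_content c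
    have h4 := row_add_content d
    have h5 : content d < content c := by omega
    rw [← enc_lt_of_gt h5]
    exact hE.col _ (enc_mem_entries.2 hm) _ (enc_mem_entries.2 hm')
      (by simp only [ct_enc]; omega) h2
  refine ⟨fun c => ?_, fun c d h1 h2 m hm m' hm' => ?_, fun c d h1 h2 m hm m' hm' => ?_,
    fun c d h1 h2 m hm hp hm' => ?_, fun c d h1 h2 m hm hp hm' => ?_⟩
  · obtain ⟨p, hp, h1, h2⟩ := (hE.fill (content c) c.1.1).1 (diag_content c)
    obtain ⟨c', m, hm, rfl⟩ := mem_entries.1 hp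
    simp only [ct_enc] at h1 h2
    obtain rfl := box_ext h2 h1
    exact ⟨m, hm⟩
  · exact (hrow c d h1 h2 m hm m' hm').elim le_of_lt fun h => h.1.le
  · exact (hcol c d h1 h2 m hm m' hm').elim le_of_lt fun h => h.1.le
  · have hp' : ¬ m.IsUnprimed := fun hu => by simp_all [Marked.IsPrimed, Marked.IsUnprimed]
    rcases lt_trichotomy c.1.2 d.1.2 with h | h | h
    · rcases hrow c d h1 h m hm m hm' with h3 | h3
      exacts [lt_irrefl _ h3, hp' h3.2]
    · exact h2 (Subtype.ext (Prod.ext h1 h))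
    · rcases hrow d c h1.symm h m hm' m hm with h3 | h3
      exacts [lt_irrefl _ h3, hp' h3.2]
  · have hp' : ¬ m.IsPrimed := fun hu => by simp_all [Marked.IsPrimed, Marked.IsUnprimed]
    rcases lt_trichotomy c.1.1 d.1.1 with h | h | h
    · rcases hcol c d h1 h m hm m hm' with h3 | h3
      exacts [lt_irrefl _ h3, hp' h3.2]
    · exact h2 (Subtype.ext (Prod.ext h h1))
    · rcases hcol d c h1.symm h m hm' m hm with h3 | h3
      exacts [lt_irrefl _ h3, hp' h3.2]

theorem IsTab.exists_entries_eq {l : List Letter} {E : Finset (Letter × ℕ)}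
    (hE : IsTab ct mu.diag l lam.diag E) : ∃ T : Filling lam mu, entries T = E := by
  classical
  refine ⟨fun c => (E.filter fun p => ct p.1 = content c ∧ p.2 = c.1.1).image fun p => mark p.1, ?_⟩
  ext p
  rw [mem_entries]
  constructor
  · rintro ⟨c, m, hm, rfl⟩
    obtain ⟨q, hq, rfl⟩ := Finset.mem_image.1 hm
    obtain ⟨hq, h1, h2⟩ := Finset.mem_filter.1 hq
    rw [← h1, ← h2, enc_mark]
    exact hq
  · intro hp
    have h1 := (hE.fill _ _).2 ⟨p, hp, rfl, rfl⟩
    have h2 : content (⟨_, mem_SD_iff.2 h1⟩ : SD lam mu) = ct p.1 := Nat.add_sub_cancel_left _ _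
    refine ⟨⟨_, mem_SD_iff.2 h1⟩, mark p.1, ?_, ?_⟩
    · exact Finset.mem_image.2 ⟨p, Finset.mem_filter.2 ⟨hp, h2.symm, rfl⟩, rfl⟩
    · rw [h2, enc_mark]

end Entries

/-! ### Coefficients and symmetry -/

section Symmetry

open Letter

/-- The tableaux of the `Q`-function (if `P` is false) or of the `P`-function (if `P` is true). -/
def tableaux (P : Prop) (lam mu : StrictPartition) : Set (Filling lam mu) :=
  {T | IsSetSSMT T ∧ (P → ∀ c : SD lam mu, c.1.1 = c.1.2 → ∀ m ∈ T c, m.IsUnprimed)}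

variable {lam mu : StrictPartition} (P : Prop)

open Classical in
/-- The variable of a letter, the variables being permuted by `σ`. In the case of the `P`-function
primed letters on the main diagonal get weight zero. -/
noncomputable def letterVar (σ : ℕ → ℕ) (a : Letter) : MvPowerSeries ℕ ℤ[X] :=
  if P ∧ IsDiagPrimed a then 0 else MvPowerSeries.X (σ (idx a))

/-- The variable `β` as a power series. -/
noncomputable def betaC : MvPowerSeries ℕ ℤ[X] := MvPowerSeries.C Polynomial.X

theorem prod_X_eq_monomial {ι : Type*} (s : Finset ι) (f : ι → ℕ) :
    ∏ p ∈ s, (MvPowerSeries.X (f p) : MvPowerSeries ℕ ℤ[X]) =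
      MvPowerSeries.monomial (∑ p ∈ s, Finsupp.single (f p) 1) 1 := by
  classical
  induction s using Finset.induction_on with
  | empty => simp [MvPowerSeries.monomial_zero_one]
  | insert a s ha ih =>
    rw [Finset.prod_insert ha, Finset.sum_insert ha, ih, MvPowerSeries.X,
      MvPowerSeries.monomial_mul_monomial, one_mul]

-- The zero weights of `letterVar` select the tableaux allowed in the `P`-case, and injectivity of
-- `σ` keeps distinct exponents distinct.
open Classical in
theorem coeff_tabWeight {σ : ℕ → ℕ} (hσ : Function.Injective σ) (e : ℕ →₀ ℕ)
    (E : Finset (Letter × ℕ)) :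
    MvPowerSeries.coeff (e.mapDomain σ) (tabWeight betaC ct (letterVar P σ) E) =
      if (∀ p ∈ E, ¬ (P ∧ IsDiagPrimed p.1)) ∧ ∑ p ∈ E, Finsupp.single (idx p.1) 1 = e
      then (Polynomial.X : ℤ[X]) ^ excess ct E else 0 := by
  by_cases h : ∀ p ∈ E, ¬ (P ∧ IsDiagPrimed p.1)
  · have h1 : ∏ p ∈ E, letterVar P σ p.1 = ∏ p ∈ E, MvPowerSeries.X (σ (idx p.1)) :=
      Finset.prod_congr rfl fun p hp => if_neg (h p hp)
    have h2 : ∑ p ∈ E, Finsupp.single (σ (idx p.1)) 1 =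
        (∑ p ∈ E, Finsupp.single (idx p.1) 1 : ℕ →₀ ℕ).mapDomain σ := by
      rw [Finsupp.mapDomain_finsetSum]
      simp only [Finsupp.mapDomain_single]
    rw [tabWeight, h1, prod_X_eq_monomial, betaC, ← map_pow, MvPowerSeries.coeff_C_mul,
      MvPowerSeries.coeff_monomial, h2]
    have h3 := (Finsupp.mapDomain_injective (M := ℕ) hσ).eq_iff (a := e)
      (b := ∑ p ∈ E, Finsupp.single (idx p.1) 1)
    by_cases h4 : e = ∑ p ∈ E, Finsupp.single (idx p.1) 1
    · rw [if_pos (h3.2 h4), if_pos ⟨h, h4.symm⟩, mul_one]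
    · rw [if_neg fun h5 => h4 (h3.1 h5), if_neg fun h5 => h4 h5.2.symm, mul_zero]
  · rw [if_neg fun h' => h h'.1]
    push Not at h
    obtain ⟨p, hp, h1⟩ := h
    rw [tabWeight, Finset.prod_eq_zero hp (if_pos h1 : letterVar P σ p.1 = 0), mul_zero, map_zero]

open Classical in
/-- The coefficients of the generating functions, in terms of box-adding operators. -/
theorem coeff_opProd (h : mu ⊆ lam) {σ : ℕ → ℕ} (hσ : Function.Injective σ) {e : ℕ →₀ ℕ} {N : ℕ}
    (he : ∀ k ∈ e.support, k < N) :
    MvPowerSeries.coeff (e.mapDomain σ)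
      (opProd betaC ct mu.diag (letterVar P σ) (alphabet (lam.parts 0 + 1) N)
        (Pi.single lam.diag 1) mu.diag) =
      MvPowerSeries.coeff e (genFun (tableaux P lam mu)) := by
  rw [opProd_apply mu.isShape_diag (pairwise_alphabet _ _), map_sum]
  have h1 : ∀ x : (ℕ → ℕ) × Finset (Letter × ℕ), MvPowerSeries.coeff (e.mapDomain σ)
      (tabWeight betaC ct (letterVar P σ) x.2 *
        (Pi.single lam.diag 1 : (ℕ → ℕ) → MvPowerSeries ℕ ℤ[X]) x.1) =
      if x.1 = lam.diag ∧ (∀ p ∈ x.2, ¬ (P ∧ IsDiagPrimed p.1)) ∧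
        ∑ p ∈ x.2, Finsupp.single (idx p.1) 1 = e
      then (Polynomial.X : ℤ[X]) ^ excess ct x.2 else 0 := by
    intro x
    rw [Pi.single_apply]
    by_cases hx : x.1 = lam.diag
    · rw [if_pos hx, mul_one, coeff_tabWeight P hσ]
      simp only [hx, true_and]
    · rw [if_neg hx, if_neg fun h' => hx h'.1, mul_zero, map_zero]
  simp only [h1]
  rw [← Finset.sum_filter]
  change _ = ∑ T ∈ (fiber_finite (tableaux P lam mu) e).toFinset,
    (Polynomial.X : ℤ[X]) ^ (size T - Fintype.card (SD lam mu))
  have hP : ∀ T : Filling lam mu, (∀ p ∈ entries T, ¬ (P ∧ IsDiagPrimed p.1)) ↔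
      (P → ∀ c : SD lam mu, c.1.1 = c.1.2 → ∀ m ∈ T c, m.IsUnprimed) := by
    intro T
    constructor
    · intro hT hp c hc m hm
      have := hT _ (enc_mem_entries.2 hm)
      rw [isDiagPrimed_enc] at this
      have h2 := row_add_content c
      refine Bool.eq_true_of_not_eq_false fun hf => this ⟨hp, hf, by omega⟩
    · rintro hT p hp ⟨hP, hd⟩
      obtain ⟨c, m, hm, rfl⟩ := mem_entries.1 hp
      rw [isDiagPrimed_enc] at hd
      have h2 := row_add_content c
      have h3 := hT hP c (by omega) m hm
      have h4 := hd.1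
      rw [Marked.IsUnprimed] at h3
      rw [Marked.IsPrimed, h3] at h4
      exact Bool.noConfusion h4
  symm
  refine Finset.sum_bij (fun T _ => (lam.diag, entries T)) ?_ ?_ ?_ ?_
  · intro T hT
    obtain ⟨⟨hT1, hT2⟩, hT3⟩ := (Set.Finite.mem_toFinset _).1 hT
    refine Finset.mem_filter.2 ⟨(mem_tabs mu.isShape_diag (pairwise_alphabet _ _)).2
      (hT1.isTab_entries h fun p hp => mem_alphabet.2 ⟨?_, ?_⟩), rfl, (hP T).2 hT2, ?_⟩
    -- Every index occurring in `T` lies in the support of its weight `e`.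
    · refine he _ ?_
      rw [← hT3, weight_eq_sum_entries, Finsupp.mem_support_iff, Finsupp.finsetSum_apply]
      refine (Finset.sum_pos' (fun _ _ => Nat.zero_le _) ⟨p, hp, ?_⟩).ne'
      simp
    · obtain ⟨c, m, hm, rfl⟩ := mem_entries.1 hp
      rw [ct_enc]
      -- Contents are already below `lam.parts 0`; the extra 1 gives the blocks the form `block k (n
      -- + 1)` used in `opProd_block`.
      exact (content_lt c).trans (Nat.lt_succ_self _)
    · rw [← hT3, weight_eq_sum_entries]
  · intro T _ T' _ hTT
    exact entries_injective (Prod.mk.inj hTT).2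
  · rintro ⟨d, E⟩ hx
    obtain ⟨hx, rfl, hx1, hx2⟩ := Finset.mem_filter.1 hx
    have hE := (mem_tabs mu.isShape_diag (pairwise_alphabet _ _)).1 hx
    obtain ⟨T, rfl⟩ := hE.exists_entries_eq
    refine ⟨T, (Set.Finite.mem_toFinset _).2 ⟨⟨isSetSSMT_of_isTab hE, (hP T).1 hx1⟩, ?_⟩, rfl⟩
    rw [weight_eq_sum_entries]
    exact hx2
  · intro T hT
    obtain ⟨⟨hT1, -⟩, -⟩ := (Set.Finite.mem_toFinset _).1 hT
    rw [excess_entries hT1.nonempty]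

open Classical in
/-- The operator adding all letters of one index. -/
noncomputable def blockOp (m : ℕ → ℕ) (n : ℕ) (x : MvPowerSeries ℕ ℤ[X]) :
    Module.End (MvPowerSeries ℕ ℤ[X]) ((ℕ → ℕ) → MvPowerSeries ℕ ℤ[X]) :=
  descProd (boxOp betaC m) x 1 n *
    hFactor (boxOp betaC m) 0 (if P then x else x + x + betaC * x * x) *
    ascProd (boxOp betaC m) x 1 n

/-- Each further content wraps the block between a primed factor on the left and an unprimed one on
the right. At content 0 the two factors merge to `h_0(x ⊕ x)`, or the primed one is 1 in the
`P`-case. -/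
theorem opProd_block (m : ℕ → ℕ) (n k : ℕ) (σ : ℕ → ℕ) :
    opProd betaC ct m (letterVar P σ) (block k (n + 1)) =
      blockOp P m n (MvPowerSeries.X (σ k)) := by
  have hstep : ∀ n, opProd betaC ct m (letterVar P σ) (block k (n + 1)) =
      hFactor (boxOp betaC m) n (letterVar P σ (toLex (k, Int.negSucc n))) *
      opProd betaC ct m (letterVar P σ) (block k n) *
      hFactor (boxOp betaC m) n (letterVar P σ (toLex (k, Int.ofNat n))) := by
    intro n
    rw [block, opProd, opProd_append, opProd, opProd, one_mul]
    rfl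
  have hpos : ∀ n, letterVar P σ (toLex (k, Int.ofNat n)) = MvPowerSeries.X (σ k) := fun n => by
    refine if_neg fun h => ?_
    have : Int.ofNat n = -1 := h.2
    simp only [Int.ofNat_eq_natCast] at this
    omega
  have hneg : ∀ n, letterVar P σ (toLex (k, Int.negSucc (n + 1))) = MvPowerSeries.X (σ k) :=
    fun n => by
    refine if_neg fun h => ?_
    have : Int.negSucc (n + 1) = -1 := h.2
    omega
  induction n with
  | zero =>
    rw [hstep, hpos, blockOp, block, opProd, descProd, ascProd, one_mul, mul_one, mul_one]
    by_cases hP : P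
    · rw [if_pos hP, letterVar, if_pos ⟨hP, rfl⟩, hFactor, zero_smul, add_zero, one_mul]
    · rw [if_neg hP, letterVar, if_neg (fun h => hP h.1), (boxOp_relations _ _).hFactor_mul]
      rfl
  | succ n ih =>
    rw [hstep, ih, hpos, hneg, blockOp, blockOp, descProd, ascProd, add_comm 1 n]
    simp only [mul_assoc]

/-- The inverse is `-X / (1 + βX)`, whose denominator has constant term 1. -/
theorem exists_formal_inverse (k : ℕ) : ∃ y : MvPowerSeries ℕ ℤ[X],
    MvPowerSeries.X k + y + betaC * MvPowerSeries.X k * y = 0 := by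
  have h : IsUnit (1 + betaC * MvPowerSeries.X k : MvPowerSeries ℕ ℤ[X]) := by
    rw [MvPowerSeries.isUnit_iff_constantCoeff]
    simp
  obtain ⟨v, hv⟩ := h.exists_right_inv
  exact ⟨-(MvPowerSeries.X k * v), by linear_combination (-MvPowerSeries.X k) * hv⟩

theorem blockOp_commute (m : ℕ → ℕ) (n j k : ℕ) :
    Commute (blockOp P m n (MvPowerSeries.X j)) (blockOp P m n (MvPowerSeries.X k)) := by
  obtain ⟨x', hx⟩ := exists_formal_inverse j
  obtain ⟨y', hy⟩ := exists_formal_inverse k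
  unfold blockOp
  split_ifs
  · exact (boxOp_relations betaC m).hProdP_commute n hx hy
  · exact (boxOp_relations betaC m).hProdQ_commute n hx hy

theorem opProd_alphabet (m : ℕ → ℕ) (n N : ℕ) (σ : ℕ → ℕ) :
    opProd betaC ct m (letterVar P σ) (alphabet (n + 1) N) =
      (((List.range N).map σ).map fun k => blockOp P m n (MvPowerSeries.X k)).prod := by
  induction N with
  | zero => rfl
  | succ N ih =>
    rw [alphabet, opProd_append, ih, opProd_block, List.range_succ]
    simp

theorem opProd_alphabet_perm (m : ℕ → ℕ) (n N : ℕ) {σ : Equiv.Perm ℕ}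
    (hσ : ∀ k, σ k < N ↔ k < N) :
    opProd betaC ct m (letterVar P σ) (alphabet (n + 1) N) =
      opProd betaC ct m (letterVar P id) (alphabet (n + 1) N) := by
  rw [opProd_alphabet, opProd_alphabet, List.map_id]
  refine List.Perm.prod_eq' (List.Perm.map _ ?_) ?_
  · refine (List.perm_ext_iff_of_nodup (List.nodup_range.map σ.injective) List.nodup_range).2
      fun k => ?_
    rw [List.mem_map, List.mem_range]
    constructor
    · rintro ⟨j, hj, rfl⟩
      exact (hσ j).2 (List.mem_range.1 hj)
    · intro hk
      refine ⟨σ.symm k, List.mem_range.2 ?_, σ.apply_symm_apply k⟩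
      rwa [← hσ, σ.apply_symm_apply]
  · refine List.pairwise_of_forall_mem_list fun x hx y hy => ?_
    obtain ⟨j, -, rfl⟩ := List.mem_map.1 hx
    obtain ⟨k, -, rfl⟩ := List.mem_map.1 hy
    exact blockOp_commute P m n j k

/-- By `coeff_opProd`, the right side is the coefficient of the permuted exponent in the operator
product with permuted variables. That product equals the unpermuted one, since its factors commute.
-/
theorem coeff_genFun_perm (h : mu ⊆ lam) {σ : Equiv.Perm ℕ} {N : ℕ} (hσ : ∀ k, σ k < N ↔ k < N)
    {e : ℕ →₀ ℕ} (he : ∀ k ∈ e.support, k < N) :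
    MvPowerSeries.coeff (e.mapDomain σ) (genFun (tableaux P lam mu)) =
      MvPowerSeries.coeff e (genFun (tableaux P lam mu)) := by
  have he' : ∀ k ∈ (e.mapDomain σ).support, k < N := by
    classical
    intro k hk
    obtain ⟨j, hj, rfl⟩ := Finset.mem_image.1 (Finsupp.mapDomain_support hk)
    exact (hσ j).2 (he j hj)
  rw [← coeff_opProd P h σ.injective he, ← coeff_opProd P h Function.injective_id he',
    Finsupp.mapDomain_id, opProd_alphabet_perm P _ _ _ hσ]

theorem exists_perm_extending {k : ℕ} {i : Fin k → ℕ} (hi : Function.Injective i) :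
    ∃ (N : ℕ) (σ : Equiv.Perm ℕ), k ≤ N ∧ (∀ j, σ j < N ↔ j < N) ∧ ∀ j : Fin k, σ j = i j := by
  classical
  obtain ⟨B, hB⟩ := (Set.finite_range i).bddAbove
  let N := max k (B + 1)
  -- The value 0 is a dummy: the extension has to agree with `f` only where `x < k`.
  let f : Finset.range N → ℕ := fun x => if hx : x.1 < k then i ⟨x.1, hx⟩ else 0
  have hf : ∀ (x : Finset.range N) (hx : x.1 < k), f x = i ⟨x.1, hx⟩ := fun x hx => dif_pos hx
  obtain ⟨g, hg⟩ := Finset.exists_equiv_extend_of_card_eq (t := Finset.range N) (by simp)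
    (s := Finset.univ.filter fun x : Finset.range N => x.1 < k) (f := f) (by
      intro y hy
      obtain ⟨x, hx, rfl⟩ := Finset.mem_image.1 hy
      rw [hf x (Finset.mem_filter.1 hx).2, Finset.mem_range]
      have := hB (Set.mem_range_self (⟨x.1, (Finset.mem_filter.1 hx).2⟩ : Fin k))
      omega) (by
      intro x hx y hy hxy
      have hx' := (Finset.mem_filter.1 (Finset.mem_coe.1 hx)).2
      have hy' := (Finset.mem_filter.1 (Finset.mem_coe.1 hy)).2
      rw [hf x hx', hf y hy'] at hxy
      exact Subtype.ext (Fin.mk.inj (hi hxy)))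
  refine ⟨N, Equiv.Perm.ofSubtype g, le_max_left _ _, fun j => ?_, fun j => ?_⟩
  · by_cases hj : j ∈ Finset.range N
    · have h1 := Equiv.Perm.ofSubtype_apply_of_mem g hj
      rw [h1]
      exact iff_of_true (Finset.mem_range.1 (g ⟨j, hj⟩).2) (Finset.mem_range.1 hj)
    · rw [Equiv.Perm.ofSubtype_apply_of_not_mem g hj]
  · have hj : (j : ℕ) ∈ Finset.range N :=
      Finset.mem_range.2 (j.2.trans_le (le_max_left _ _))
    rw [Equiv.Perm.ofSubtype_apply_of_mem g hj, hg _ (by simp), hf _ j.2]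

theorem genFun_tableaux_mem_mSym (h : mu ⊆ lam) : genFun (tableaux P lam mu) ∈ mSym := by
  intro k a i _ hi
  obtain ⟨N, σ, hkN, hσ, hσi⟩ := exists_perm_extending hi
  have h1 : ∑ j, Finsupp.single (i j) (a j) =
      (∑ j : Fin k, Finsupp.single (j : ℕ) (a j)).mapDomain σ := by
    rw [Finsupp.mapDomain_finsetSum]
    simp only [Finsupp.mapDomain_single, hσi]
  rw [h1]
  refine coeff_genFun_perm P h hσ fun j hj => ?_
  obtain ⟨t, -, ht⟩ := Finset.mem_biUnion.1 (Finsupp.support_finsetSum hj)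
  have := Finsupp.support_single_subset ht
  rw [Finset.mem_singleton] at this
  omega

end Symmetry

end ShiftedK

theorem mainTheorem1 (lam mu : ShiftedK.StrictPartition) (h : mu ⊆ lam) :
    ShiftedK.GP lam mu ∈ ShiftedK.mSym ∧ ShiftedK.GQ lam mu ∈ ShiftedK.mSym := by
  have hP : ShiftedK.SetSSMTP lam mu = ShiftedK.tableaux True lam mu := by
    simp [ShiftedK.SetSSMTP, ShiftedK.tableaux]
  have hQ : ShiftedK.SetSSMT lam mu = ShiftedK.tableaux False lam mu := by
    simp [ShiftedK.SetSSMT, ShiftedK.tableaux]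
  rw [ShiftedK.GP, ShiftedK.GQ, hP, hQ]
  exact ⟨ShiftedK.genFun_tableaux_mem_mSym _ h, ShiftedK.genFun_tableaux_mem_mSym _ h⟩
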